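/- **Setting.** Let $L\ge 1$, $n_0,\dots,n_{L+1}\ge 1$ be integers, $C_W>0$, $C_b\ge 0$, let $\sigma:\mathbb R\to\mathbb R$ be Borel measurable (for instance Lipschitz continuous) and $x\in\mathbb R^{n_0}$. Define $$z_j^{(1)}(x)=b_j^{(1)}+\sqrt{\tfrac{C_W}{n_0}}\sum_{k=1}^{n_0}W^{(1)}_{j,k}x_k,\qquad z_j^{(\ell)}(x)=b_j^{(\ell)}+\sqrt{\tfrac{C_W}{n_{\ell-1}}}\sum_{k=1}^{n_{\ell-1}}W^{(\ell)}_{j,k}\,\sigma\big(z_k^{(\ell-1)}(x)\big)\quad(2\le \ell\le L+1),$$ for $1\le j\le n_\ell$, where the biases $b_j^{(\ell)}\sim\mathcal N(0,C_b)$ and the weights $W_{j,k}^{(\ell)}$ are all mutually independent and the weights are identically distributed with mean $0$ and variance $1$. Define $K^{(2)}=C_b+C_W\,\mathbb E[\sigma(z_1^{(1)}(x))^2]$ and $K^{(\ell+1)}=C_b+C_W\,\mathbb E[\sigma(G^{(\ell)})^2]$ with $G^{(\ell)}\sim\mathcal N(0,K^{(\ell)})$ for $\ell\ge 2$. (For Lipschitz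 $\sigma$ these expectations are finite; for other $\sigma$ a divergent one is read as $0$.) Put $$Q_2^{(L)}(x)=\mathbb E\Big[\Big|\sum_{j=1}^{n_L}\frac{C_W}{n_L}\sigma\big(z_j^{(L)}(x)\big)^2-K^{(L+1)}+C_b\Big|^2\Big].$$ Let $d_K(X,Y)=\sup_{t\in\mathbb R}|\mathbb P(X\le t)-\mathbb P(Y\le t)|$ be the Kolmogorov distance. **(1)** If $\mathbb E[(W_{1,1}^{(1)})^6]<\infty$, $\mathbb E[|\sigma(z_1^{(L)}(x))|^6]<\infty$ and $K^{(L+1)}\ne 0$, then, with $G_1^{(L+1)}(x)\sim\mathcal N(0,K^{(L+1)})$, $$d_K\big(z_1^{(L+1)}(x),G_1^{(L+1)}(x)\big)\le\frac{\sqrt{Q_2^{(L)}(x)}}{K^{(L+1)}}+\frac{C_W}{K^{(L+1)}\sqrt{n_L}}\,\mathbb E\big[(W_{1,1}^{(1)})^6\big]^{1/2}\Big(1+\mathbb E\big[|\sigma(z_1^{(L)}(x))|^6\big]^{1/2}\Big)\Big(2\sqrt{\tfrac{C_W}{K^{(L+1)}}}+2\sqrt{C_W}\Big(\sqrt{\tfrac{C_b}{K^{(L+1)}}}+\tfrac{\sqrt{2\pi}}4\Big)+\tfrac52\Big).$$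 **(2)** Let $E$ be a Polish space, $X=(X_1,\dots,X_k)$ a random vector in $E^k$ with independent components, $X'$ an independent copy of $X$, $f:E^k\to\mathbb R$ measurable with $\mathbb E[f(X)]=0$ and $\mathbb E[f(X)^6]<\infty$, let $C_b\ge0$, let $b\sim\mathcal N(0,C_b)$ be independent of $X$, and let $N\sim\mathcal N(0,K)$ with $K>0$. For $A\subseteq[k]=\{1,\dots,k\}$ let $X^A$ be the vector whose $i$-th coordinate is $X_i'$ if $i\in A$ and $X_i$ if $i\notin A$; for $j\notin A$ put $\Delta_jf(X^A)=f(X^A)-f(X^{A\cup\{j\}})$, and $\Delta_jf(X)=\Delta_jf(X^{\emptyset})$. Put $$T=\frac12\sum_{A\subsetneq[k]}\frac{1}{\binom k{|A|}(k-|A|)}\sum_{j\notin A}\Delta_jf(X)\,\Delta_jf(X^A),\qquad T'=\frac12\sum_{A\subsetneq[k]}\frac{1}{\binom k{|A|}(k-|A|)}\sum_{j\notin A}\Delta_jf(X)\,\big|\Delta_jf(X^A)\big|.$$ Then $$d_K(b+f(X),N)\le\frac1K\,\mathbb E\Big[\big(\mathbb E[K-C_b-T\mid X]\big)^2\Big]^{1/2}+\frac1K\big(\operatorname{Var}\mathbb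 E[T'\mid X]\big)^{1/2}+\frac14\Big(\sqrt{\tfrac{C_b}K}+\tfrac{\sqrt{2\pi}}4\Big)\sum_{j=1}^k\frac1K\,\mathbb E\big[|\Delta_jf(X)|^3\big]+\frac1{4K\sqrt K}\sum_{j=1}^k\mathbb E\big[|\Delta_jf(X)|^6\big]^{1/2}.$$ -/

import Mathlib

open MeasureTheory ProbabilityTheory
open scoped NNReal

noncomputable section

/-- Kolmogorov distance `sup_t |μ (-∞, t] - ν (-∞, t]|` between two laws on the real line
(used for probability measures only, where the supremum is over a bounded set). -/
def kolDist (μ ν : Measure ℝ) : ℝ :=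
  ⨆ t : ℝ, |μ.real (Set.Iic t) - ν.real (Set.Iic t)|

/-- A random fully connected neural network with `L` hidden layers on the probability space
`(Ω, P)`.

`width ℓ` is the number of neurons `n_ℓ` of layer `ℓ` (`n_0` is the input dimension), and
`weight ℓ j k`, `bias ℓ j` are the parameters which lead from layer `ℓ` to layer `ℓ + 1`, that is
`W_{j,k}^{(ℓ+1)}` and `b_j^{(ℓ+1)}`.
Only layers `0, …, L + 1` and parameters with `ℓ ≤ L` belong to the network: nothing is assumed on
the other entries (except that the unused widths are positive). -/
structure RandomNN {Ω : Type*} [MeasurableSpace Ω] (P : Measure Ω) (L : ℕ) where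
  width : ℕ → ℕ
  width_pos : ∀ ℓ, 0 < width ℓ
  /-- activation function -/
  σ : ℝ → ℝ
  measurable_σ : Measurable σ
  /-- weight variance `C_W > 0` -/
  CW : ℝ≥0
  CW_pos : 0 < CW
  /-- bias variance `C_b ≥ 0` -/
  Cb : ℝ≥0
  weight : (ℓ : ℕ) → Fin (width (ℓ + 1)) → Fin (width ℓ) → Ω → ℝ
  bias : (ℓ : ℕ) → Fin (width (ℓ + 1)) → Ω → ℝ
  measurable_weight : ∀ ℓ ≤ L, ∀ j k, Measurable (weight ℓ j k)
  measurable_bias : ∀ ℓ ≤ L, ∀ j, Measurable (bias ℓ j)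
  /-- the law of the generic weight `W` -/
  weightLaw : Measure ℝ
  memLp_weightLaw : MemLp id 2 weightLaw
  mean_weightLaw : ∫ w, w ∂weightLaw = 0
  sq_weightLaw : ∫ w, w ^ 2 ∂weightLaw = 1
  hasLaw_weight : ∀ ℓ ≤ L, ∀ j k, HasLaw (weight ℓ j k) weightLaw P
  hasLaw_bias : ∀ ℓ ≤ L, ∀ j, HasLaw (bias ℓ j) (gaussianReal 0 Cb) P
  /-- all the weights and all the biases together are mutually independent -/
  indep : iIndepFun
    (Sum.elim
      (fun p : Σ ℓ : Fin (L + 1), Fin (width (ℓ + 1)) × Fin (width ℓ) =>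
        weight p.1 p.2.1 p.2.2)
      (fun p : Σ ℓ : Fin (L + 1), Fin (width (ℓ + 1)) => bias p.1 p.2)) P

namespace RandomNN

variable {Ω : Type*} [MeasurableSpace Ω] {P : Measure Ω} {L : ℕ}

/-- The index of the first neuron of layer `ℓ`. -/
def fst (N : RandomNN P L) (ℓ : ℕ) : Fin (N.width ℓ) := ⟨0, N.width_pos ℓ⟩

/-- `N.z x ℓ j` is the random variable `z_j^{(ℓ)}(x)`, for `ℓ = 1, …, L + 1`; by convention
`N.z x 0` is the input `x`. -/
def z (N : RandomNN P L) (x : Fin (N.width 0) → ℝ) : (ℓ : ℕ) → Fin (N.width ℓ) → Ω → ℝ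
  | 0 => fun k _ => x k
  | 1 => fun j ω => N.bias 0 j ω +
      √(N.CW : ℝ) / √(N.width 0 : ℝ) * ∑ k, N.weight 0 j k ω * x k
  | ℓ + 2 => fun j ω => N.bias (ℓ + 1) j ω +
      √(N.CW : ℝ) / √(N.width (ℓ + 1) : ℝ) *
        ∑ k, N.weight (ℓ + 1) j k ω * N.σ (N.z x (ℓ + 1) k ω)

/-- `N.K x ℓ` is the infinite-width variance `K^{(ℓ)}` at the input `x`, for `ℓ ≥ 2`:
`K^{(2)} = C_b + C_W E[σ(z_1^{(1)}(x))²]` and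
`K^{(ℓ+1)} = C_b + C_W E[σ(G)²]` with `G ∼ N(0, K^{(ℓ)})`.
The values at `0` and `1` are unused. -/
def K (N : RandomNN P L) (x : Fin (N.width 0) → ℝ) : ℕ → ℝ≥0
  | 0 => 0
  | 1 => 0
  | 2 => N.Cb + N.CW * (∫ ω, N.σ (N.z x 1 (N.fst 1) ω) ^ 2 ∂P).toNNReal
  | ℓ + 3 => N.Cb + N.CW * (∫ y, N.σ y ^ 2 ∂(gaussianReal 0 (N.K x (ℓ + 2)))).toNNReal

/-- `Q_p^{(ℓ)}(x) = E |∑_j (C_W / n_ℓ) σ(z_j^{(ℓ)}(x))² - K^{(ℓ+1)} + C_b|^p`. -/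
def Q (N : RandomNN P L) (x : Fin (N.width 0) → ℝ) (p ℓ : ℕ) : ℝ :=
  ∫ ω, |∑ j, (N.CW : ℝ) / (N.width ℓ : ℝ) * N.σ (N.z x ℓ j ω) ^ 2
    - (N.K x (ℓ + 1) : ℝ) + (N.Cb : ℝ)| ^ p ∂P

end RandomNN

section Resampling

variable {E : Type*} {k : ℕ}

/-- `X^A`: the coordinates in `A` are taken from `x'`, the others from `x`. -/
def resample (x x' : Fin k → E) (A : Finset (Fin k)) : Fin k → E :=
  fun i => if i ∈ A then x' i else x i

/-- `Δ_j f (X^A) = f(X^A) - f(X^{A ∪ {j}})`; in particular for `A = ∅` this is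
`Δ_j f(X) = f(X) - f(X^j)`, where `X^j` is `X` with its `j`-th coordinate taken from `X'`. -/
def resampleDiff (f : (Fin k → E) → ℝ) (j : Fin k) (A : Finset (Fin k)) (x x' : Fin k → E) : ℝ :=
  f (resample x x' A) - f (resample x x' (insert j A))

/-- `T = ½ ∑_{A ⊊ [k]} 1 / (C(k,|A|) (k - |A|)) ∑_{j ∉ A} Δ_j f(X) Δ_j f(X^A)`. -/
def steinT (f : (Fin k → E) → ℝ) (x x' : Fin k → E) : ℝ :=
  1 / 2 * ∑ A ∈ (Finset.univ : Finset (Fin k)).ssubsets,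
    1 / ((k.choose A.card : ℝ) * ((k : ℝ) - (A.card : ℝ))) *
      ∑ j ∈ Aᶜ, resampleDiff f j ∅ x x' * resampleDiff f j A x x'

/-- `T' = ½ ∑_{A ⊊ [k]} 1 / (C(k,|A|) (k - |A|)) ∑_{j ∉ A} Δ_j f(X) |Δ_j f(X^A)|`. -/
def steinT' (f : (Fin k → E) → ℝ) (x x' : Fin k → E) : ℝ :=
  1 / 2 * ∑ A ∈ (Finset.univ : Finset (Fin k)).ssubsets,
    1 / ((k.choose A.card : ℝ) * ((k : ℝ) - (A.card : ℝ))) *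
      ∑ j ∈ Aᶜ, resampleDiff f j ∅ x x' * |resampleDiff f j A x x'|

end Resampling

end

/-! The bounded solution `F` of Stein's equation for `N(0, K)` and the indicator of `(-∞, t]` is
smooth except at `t`, where its slope drops by `1 / K`. Hence `F + |· - t| / (2 K)` is convex, and
`F = H₁ - H₂` is a difference of two convex functions with slopes in `[-1 / (2 K), 1 / (2 K)]`; its
first-order Taylor remainder is at most that of `H₁ + H₂`. Multiplied by `|Δ_j f(X^A)|`, which is
symmetric under exchanging `X_j` and `X_j'`, the increments of `H₁ + H₂` integrate to zero; what
remains is `E[ψ(f(X)) T']` with `|ψ| ≤ 1 / K`. Chatterjee's covariance identity then bounds the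
distance in terms of `T` and `T'` alone. All of this survives averaging over the Gaussian noise `b`,
where Gaussian integration by parts replaces `K` by `K - C_b`.

Given the outputs of the preceding layer, a neuron is its Gaussian bias plus a linear form in i.i.d.
weights, for which `T` and `T'` are explicit sums of independent terms. -/

noncomputable section

open Set Filter Topology

section Gaussian

variable {m : ℝ} {v : ℝ≥0}

lemma integrable_gaussianReal_iff (hv : v ≠ 0) {f : ℝ → ℝ} :
    Integrable f (gaussianReal m v) ↔ Integrable fun x => gaussianPDFReal m v x * f x := by
  rw [gaussianReal_of_var_ne_zero _ hv, integrable_withDensity_iff_integrable_smul'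
    (measurable_gaussianPDF _ _) (by simp [gaussianPDF_lt_top])]
  simp [toReal_gaussianPDF]

lemma integrable_pow_gaussianReal (m : ℝ) (v : ℝ≥0) (n : ℕ) :
    Integrable (fun x : ℝ => x ^ n) (gaussianReal m v) :=
  (integrable_norm_iff (by fun_prop)).1 <| by
    simpa using (memLp_id_gaussianReal' (μ := m) (v := v) n (by simp)).integrable_norm_pow'

lemma hasDerivAt_gaussianPDFReal (m : ℝ) (v : ℝ≥0) (x : ℝ) :
    HasDerivAt (gaussianPDFReal m v) (-((x - m) / v) * gaussianPDFReal m v x) x := by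
  have h : HasDerivAt (fun x : ℝ => -(x - m) ^ 2 / (2 * (v : ℝ))) (-((x - m) / v)) x :=
    ((((hasDerivAt_id x).sub_const m).pow 2).neg.div_const (2 * (v : ℝ))).congr_deriv (by
      rw [id_eq, pow_one]; push_cast; rw [neg_div, mul_one, mul_div_mul_left _ _ two_ne_zero])
  rw [gaussianPDFReal_def]
  exact (h.exp.const_mul (√(2 * Real.pi * v))⁻¹).congr_deriv (by ring)

lemma continuous_gaussianPDFReal (m : ℝ) (v : ℝ≥0) : Continuous (gaussianPDFReal m v) :=
  continuous_iff_continuousAt.2 fun x => (hasDerivAt_gaussianPDFReal m v x).continuousAt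

lemma gaussianPDFReal_zero_neg (v : ℝ≥0) (w : ℝ) :
    gaussianPDFReal 0 v (-w) = gaussianPDFReal 0 v w := by
  simp [gaussianPDFReal_def]

lemma integral_eq_zero_of_hasDerivAt_of_ne {u u' : ℝ → ℝ} {a : ℝ} (hu : Continuous u)
    (hd : ∀ x ≠ a, HasDerivAt u (u' x) x) (iu : Integrable u) (iu' : Integrable u') :
    ∫ x, u' x = 0 := by
  have left : ∫ x in Iic a, u' x = u a - 0 :=
    integral_Iic_of_hasDerivAt_of_tendsto hu.continuousWithinAt
      (fun x hx => hd x (ne_of_lt hx)) iu'.integrableOn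
      (tendsto_zero_of_hasDerivAt_of_integrableOn_Iic (a := a - 1)
        (fun x hx => hd x (by simp only [mem_Iic] at hx; linarith))
        iu'.integrableOn iu.integrableOn)
  have right : ∫ x in Ioi a, u' x = 0 - u a :=
    integral_Ioi_of_hasDerivAt_of_tendsto hu.continuousWithinAt
      (fun x hx => hd x (ne_of_gt hx)) iu'.integrableOn
      (tendsto_zero_of_hasDerivAt_of_integrableOn_Ioi (a := a)
        (fun x hx => hd x (ne_of_gt hx)) iu'.integrableOn iu.integrableOn)
  rw [← intervalIntegral.integral_Iic_add_Ioi (b := a) iu'.integrableOn iu'.integrableOn,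
    left, right]
  ring

lemma integral_sub_mul_gaussianReal_eq {G G' : ℝ → ℝ} {a : ℝ} (hG : Continuous G)
    (hd : ∀ x ≠ a, HasDerivAt G (G' x) x) (iG : Integrable G (gaussianReal m v))
    (ixG : Integrable (fun x => (x - m) * G x) (gaussianReal m v))
    (iG' : Integrable G' (gaussianReal m v)) :
    ∫ x, (x - m) * G x ∂gaussianReal m v = v * ∫ x, G' x ∂gaussianReal m v := by
  rcases eq_or_ne v 0 with rfl | hv
  · simp [gaussianReal_zero_var]
  have hv' : (v : ℝ) ≠ 0 := NNReal.coe_ne_zero.2 hv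
  have hzero : ∫ x, gaussianPDFReal m v x * ((x - m) * G x - v * G' x) = 0 := by
    refine integral_eq_zero_of_hasDerivAt_of_ne (a := a)
      (u := fun x => -v * (gaussianPDFReal m v x * G x))
      (continuous_const.mul ((continuous_gaussianPDFReal m v).mul hG)) (fun x hx => ?_)
      (((integrable_gaussianReal_iff hv).1 iG).const_mul _)
      ((integrable_gaussianReal_iff hv).1 (ixG.sub (iG'.const_mul _)))
    refine (((hasDerivAt_gaussianPDFReal m v x).mul (hd x hx)).const_mul (-(v : ℝ))).congr_deriv ?_
    field_simp
    ring
  rw [← sub_eq_zero, ← integral_const_mul, ← integral_sub ixG (iG'.const_mul _),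
    integral_gaussianReal_eq_integral_smul hv]
  exact hzero

lemma cdf_gaussianReal_eq_integral (hv : v ≠ 0) (w : ℝ) :
    cdf (gaussianReal m v) w = ∫ x in Iic w, gaussianPDFReal m v x := by
  rw [cdf_eq_real, measureReal_def, gaussianReal_apply_eq_integral m hv, ENNReal.toReal_ofReal]
  exact integral_nonneg fun x => gaussianPDFReal_nonneg m v x

lemma hasDerivAt_cdf_gaussianReal (hv : v ≠ 0) (w : ℝ) :
    HasDerivAt (cdf (gaussianReal m v)) (gaussianPDFReal m v w) w := by
  have hc := continuous_gaussianPDFReal m v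
  have hi : Integrable (gaussianPDFReal m v) := integrable_gaussianPDFReal m v
  have e : ⇑(cdf (gaussianReal m v)) =
      fun w => cdf (gaussianReal m v) 0 + ∫ x in (0 : ℝ)..w, gaussianPDFReal m v x := by
    funext w
    rw [cdf_gaussianReal_eq_integral hv, cdf_gaussianReal_eq_integral hv,
      ← intervalIntegral.integral_Iic_sub_Iic hi.integrableOn hi.integrableOn]
    ring
  rw [e]
  exact (intervalIntegral.integral_hasDerivAt_right hi.intervalIntegrable
    (hc.stronglyMeasurableAtFilter _ _) hc.continuousAt).const_add _

lemma cdf_gaussianReal_neg (hv : v ≠ 0) (w : ℝ) :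
    cdf (gaussianReal 0 v) (-w) = 1 - cdf (gaussianReal 0 v) w := by
  have := nullSingletonClass_gaussianReal (μ := 0) hv
  have hm : (gaussianReal 0 v).map (fun x => -x) = gaussianReal 0 v := by
    rw [gaussianReal_map_neg, neg_zero]
  have h1 : (gaussianReal 0 v).real (Iic (-w)) = (gaussianReal 0 v).real (Ici w) := by
    rw [← hm, map_measureReal_apply measurable_neg measurableSet_Iic, hm, neg_preimage, neg_Iic,
      neg_neg]
  rw [cdf_eq_real, cdf_eq_real, h1, ← probReal_compl_eq_one_sub measurableSet_Iic, compl_Iic]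
  exact measureReal_congr Ioi_ae_eq_Ici.symm

lemma integral_Iic_eq_of_hasDerivAt {u u' : ℝ → ℝ} (hd : ∀ x, HasDerivAt u (u' x) x)
    (iu : Integrable u) (iu' : Integrable u') (w : ℝ) : ∫ x in Iic w, u' x = u w := by
  rw [integral_Iic_of_hasDerivAt_of_tendsto' (fun x _ => hd x) iu'.integrableOn
    (tendsto_zero_of_hasDerivAt_of_integrableOn_Iic (a := w) (fun x _ => hd x) iu'.integrableOn
      iu.integrableOn), sub_zero]

lemma integral_Iic_gaussianPDFReal_mul_id (hv : v ≠ 0) (w : ℝ) :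
    ∫ x in Iic w, gaussianPDFReal 0 v x * x = -(v * gaussianPDFReal 0 v w) := by
  have hv' : (v : ℝ) ≠ 0 := NNReal.coe_ne_zero.2 hv
  refine integral_Iic_eq_of_hasDerivAt (u := fun x => -(v * gaussianPDFReal 0 v x)) (fun x => ?_)
    ((integrable_gaussianPDFReal 0 v).const_mul _).neg
    ((integrable_gaussianReal_iff hv).1 (by simpa using integrable_pow_gaussianReal 0 v 1)) w
  exact ((hasDerivAt_gaussianPDFReal 0 v x).const_mul (v : ℝ)).neg.congr_deriv (by field_simp; simp)

lemma integral_Iic_gaussianPDFReal_mul_sq (hv : v ≠ 0) (w : ℝ) :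
    ∫ x in Iic w, gaussianPDFReal 0 v x * x ^ 2 =
      v * cdf (gaussianReal 0 v) w - v * w * gaussianPDFReal 0 v w := by
  have hv' : (v : ℝ) ≠ 0 := NNReal.coe_ne_zero.2 hv
  have i0 : Integrable (gaussianPDFReal 0 v) := integrable_gaussianPDFReal 0 v
  have i1 : Integrable (fun x => gaussianPDFReal 0 v x * x) :=
    (integrable_gaussianReal_iff hv).1 (by simpa using integrable_pow_gaussianReal 0 v 1)
  have i2 : Integrable (fun x => gaussianPDFReal 0 v x * x ^ 2) :=
    (integrable_gaussianReal_iff hv).1 (integrable_pow_gaussianReal 0 v 2)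
  have h : ∫ x in Iic w, (gaussianPDFReal 0 v x * x ^ 2 - v * gaussianPDFReal 0 v x) =
      -(v * (gaussianPDFReal 0 v w * w)) := by
    refine integral_Iic_eq_of_hasDerivAt (u := fun x => -(v * (gaussianPDFReal 0 v x * x)))
      (u' := fun x => gaussianPDFReal 0 v x * x ^ 2 - v * gaussianPDFReal 0 v x)
      (fun x => ?_) (i1.const_mul _).neg (i2.sub (i0.const_mul _)) w
    refine (((hasDerivAt_gaussianPDFReal 0 v x).mul (hasDerivAt_id x)).const_mul
      (v : ℝ)).neg.congr_deriv ?_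
    simp only [id_eq, sub_zero]
    field_simp
    ring
  rw [integral_sub i2.integrableOn (i0.const_mul _).integrableOn, integral_const_mul,
    ← cdf_gaussianReal_eq_integral hv] at h
  linarith

lemma mul_cdf_gaussianReal_add_nonneg (hv : v ≠ 0) (w : ℝ) :
    0 ≤ w * cdf (gaussianReal 0 v) w + v * gaussianPDFReal 0 v w := by
  have i0 : Integrable (gaussianPDFReal 0 v) := integrable_gaussianPDFReal 0 v
  have i1 : Integrable (fun x => gaussianPDFReal 0 v x * x) :=
    (integrable_gaussianReal_iff hv).1 (by simpa using integrable_pow_gaussianReal 0 v 1)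
  calc 0 ≤ ∫ x in Iic w, (w * gaussianPDFReal 0 v x - gaussianPDFReal 0 v x * x) :=
        setIntegral_nonneg measurableSet_Iic fun x (hx : x ≤ w) => by
          nlinarith [gaussianPDFReal_nonneg 0 v x]
    _ = _ := by
      rw [integral_sub (i0.const_mul _).integrableOn i1.integrableOn, integral_const_mul,
        ← cdf_gaussianReal_eq_integral hv, integral_Iic_gaussianPDFReal_mul_id hv]
      ring

lemma add_sq_mul_cdf_gaussianReal_add_nonneg (hv : v ≠ 0) (w : ℝ) :
    0 ≤ (v + w ^ 2) * cdf (gaussianReal 0 v) w + v * w * gaussianPDFReal 0 v w := by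
  have i0 : Integrable (gaussianPDFReal 0 v) := integrable_gaussianPDFReal 0 v
  have i1 : Integrable (fun x => gaussianPDFReal 0 v x * x) :=
    (integrable_gaussianReal_iff hv).1 (by simpa using integrable_pow_gaussianReal 0 v 1)
  have i2 : Integrable (fun x => gaussianPDFReal 0 v x * x ^ 2) :=
    (integrable_gaussianReal_iff hv).1 (integrable_pow_gaussianReal 0 v 2)
  have i21 : Integrable fun x =>
      gaussianPDFReal 0 v x * x ^ 2 - 2 * w * (gaussianPDFReal 0 v x * x) :=
    i2.sub (i1.const_mul _)
  calc 0 ≤ ∫ x in Iic w, (gaussianPDFReal 0 v x * x ^ 2 - 2 * w * (gaussianPDFReal 0 v x * x) +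
          w ^ 2 * gaussianPDFReal 0 v x) :=
        setIntegral_nonneg measurableSet_Iic fun x _ => by
          nlinarith [mul_nonneg (gaussianPDFReal_nonneg 0 v x) (sq_nonneg (w - x))]
    _ = _ := by
      rw [integral_add i21.integrableOn (i0.const_mul _).integrableOn,
        integral_sub i2.integrableOn (i1.const_mul _).integrableOn, integral_const_mul,
        integral_const_mul, ← cdf_gaussianReal_eq_integral hv,
        integral_Iic_gaussianPDFReal_mul_id hv, integral_Iic_gaussianPDFReal_mul_sq hv]
      ring

end Gaussian

section MillsRatio

variable {v : ℝ≥0}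

/-- The reflected Mills ratio `Φ(w) / φ(w)` of the law `N(0, v)`, from which the solutions of
Stein's equation are built. -/
def mills (v : ℝ≥0) (w : ℝ) : ℝ := cdf (gaussianReal 0 v) w / gaussianPDFReal 0 v w

/-- The derivative of the reflected Mills ratio. -/
def millsDeriv (v : ℝ≥0) (w : ℝ) : ℝ := 1 + w * mills v w / v

lemma hasDerivAt_mills (hv : v ≠ 0) (w : ℝ) : HasDerivAt (mills v) (millsDeriv v w) w := by
  have hp := (gaussianPDFReal_pos 0 v w hv).ne'
  refine ((hasDerivAt_cdf_gaussianReal hv w).div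
    (hasDerivAt_gaussianPDFReal 0 v w) hp).congr_deriv ?_
  simp only [millsDeriv, mills]
  field_simp
  ring

lemma millsDeriv_nonneg (hv : v ≠ 0) (w : ℝ) : 0 ≤ millsDeriv v w := by
  have hp := gaussianPDFReal_pos 0 v w hv
  have : 0 < (v : ℝ) := by positivity
  have : millsDeriv v w = (w * cdf (gaussianReal 0 v) w + v * gaussianPDFReal 0 v w) /
      (v * gaussianPDFReal 0 v w) := by
    simp only [millsDeriv, mills]
    field_simp
    ring
  rw [this]
  exact div_nonneg (mul_cdf_gaussianReal_add_nonneg hv w) (by positivity)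

lemma monotone_millsDeriv (hv : v ≠ 0) : Monotone (millsDeriv v) := by
  have hd : ∀ w, HasDerivAt (millsDeriv v) ((1 * mills v w + w * millsDeriv v w) / v) w :=
    fun w => (((hasDerivAt_id w).mul (hasDerivAt_mills hv w)).div_const (v : ℝ)).const_add 1
  refine monotone_of_hasDerivAt_nonneg hd fun w => ?_
  have hp := gaussianPDFReal_pos 0 v w hv
  have : 0 < (v : ℝ) := by positivity
  have : (1 * mills v w + w * millsDeriv v w) / v =
      ((v + w ^ 2) * cdf (gaussianReal 0 v) w + v * w * gaussianPDFReal 0 v w) /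
        (v ^ 2 * gaussianPDFReal 0 v w) := by
    simp only [millsDeriv, mills]
    field_simp
    ring
  rw [this]
  exact div_nonneg (add_sq_mul_cdf_gaussianReal_add_nonneg hv w) (by positivity)

lemma one_sub_cdf_mul_mills (hv : v ≠ 0) (t : ℝ) :
    (1 - cdf (gaussianReal 0 v) t) * mills v t = cdf (gaussianReal 0 v) t * mills v (-t) := by
  rw [mills, mills, cdf_gaussianReal_neg hv, gaussianPDFReal_zero_neg]
  ring

end MillsRatio

/-- `h` selects a subgradient of `H` at every point; in particular `H` is convex. -/
def IsSubgradient (H h : ℝ → ℝ) : Prop := ∀ w w', h w * (w' - w) ≤ H w' - H w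

namespace IsSubgradient

variable {H h H₁ h₁ H₂ h₂ : ℝ → ℝ}

lemma of_hasDerivAt (hd : ∀ w, HasDerivAt H (h w) w) (hm : Monotone h) : IsSubgradient H h := by
  have hc : ConvexOn ℝ univ H := by
    refine Monotone.convexOn_univ_of_deriv (fun x => (hd x).differentiableAt) ?_
    rwa [show deriv H = h from funext fun x => (hd x).deriv]
  intro w w'
  rcases lt_trichotomy w w' with hlt | rfl | hgt
  · have := hc.le_slope_of_hasDerivAt (mem_univ w) (mem_univ w') hlt (hd w)
    rwa [slope_def_field, le_div_iff₀ (sub_pos.2 hlt)] at this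
  · simp
  · have := hc.slope_le_of_hasDerivAt (mem_univ w') (mem_univ w) hgt (hd w)
    rw [slope_def_field, div_le_iff₀ (sub_pos.2 hgt)] at this
    linarith

lemma linear (a b : ℝ) : IsSubgradient (fun w => a * w + b) fun _ => a := fun w w' => by
  linarith

lemma add (H₁h₁ : IsSubgradient H₁ h₁) (H₂h₂ : IsSubgradient H₂ h₂) :
    IsSubgradient (fun w => H₁ w + H₂ w) fun w => h₁ w + h₂ w := fun w w' => by
  linarith [H₁h₁ w w', H₂h₂ w w']

lemma const_mul (Hh : IsSubgradient H h) {a : ℝ} (ha : 0 ≤ a) :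
    IsSubgradient (fun w => a * H w) fun w => a * h w := fun w w' => by
  linarith [mul_le_mul_of_nonneg_left (Hh w w') ha]

lemma comp_neg (Hh : IsSubgradient H h) : IsSubgradient (fun w => H (-w)) fun w => -h (-w) :=
  fun w w' => by linarith [Hh (-w) (-w')]

lemma monotone (Hh : IsSubgradient H h) : Monotone h := by
  intro w w' hw
  rcases hw.eq_or_lt with rfl | hlt
  · rfl
  · nlinarith [Hh w w', Hh w' w]

lemma ite (H₁h₁ : IsSubgradient H₁ h₁) (H₂h₂ : IsSubgradient H₂ h₂) {t : ℝ} (hH : H₁ t = H₂ t)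
    (hh : h₁ t ≤ h₂ t) :
    IsSubgradient (fun w => if w ≤ t then H₁ w else H₂ w)
      fun w => if w ≤ t then h₁ w else h₂ w := by
  intro w w'
  by_cases hw : w ≤ t <;> by_cases hw' : w' ≤ t <;>
    simp only [hw, hw', if_true, if_false]
  · exact H₁h₁ w w'
  · have := H₁h₁.monotone hw
    nlinarith [H₁h₁ w t, H₂h₂ t w']
  · have := H₂h₂.monotone (not_le.1 hw).le
    nlinarith [H₂h₂ w t, H₁h₁ t w']
  · exact H₂h₂ w w'

lemma lipschitzWith (Hh : IsSubgradient H h) {C : ℝ} (hC : ∀ w, |h w| ≤ C) :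
    LipschitzWith C.toNNReal H := by
  have key : ∀ w w', H w - H w' ≤ C * |w - w'| := fun w w' =>
    calc H w - H w' ≤ h w * (w - w') := by linarith [Hh w w']
      _ ≤ |h w| * |w - w'| := by rw [← abs_mul]; exact le_abs_self _
      _ ≤ C * |w - w'| := mul_le_mul_of_nonneg_right (hC w) (abs_nonneg _)
  refine LipschitzWith.of_dist_le' fun w w' => ?_
  rw [Real.dist_eq, Real.dist_eq]
  exact abs_le'.2 ⟨key w w', by rw [neg_sub, abs_sub_comm]; exact key w' w⟩

lemma integral_comp_add {ν : Measure ℝ} (Hh : IsSubgradient H h)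
    (iH : ∀ y, Integrable (fun b => H (b + y)) ν) (ih : ∀ y, Integrable (fun b => h (b + y)) ν) :
    IsSubgradient (fun y => ∫ b, H (b + y) ∂ν) fun y => ∫ b, h (b + y) ∂ν := by
  intro y y'
  rw [← integral_mul_const, ← integral_sub (iH y') (iH y)]
  refine integral_mono ((ih y).mul_const _) ((iH y').sub (iH y)) fun b => ?_
  simpa using Hh (b + y) (b + y')

lemma abs_taylor_sub_le (H₁h₁ : IsSubgradient H₁ h₁) (H₂h₂ : IsSubgradient H₂ h₂) (w w' : ℝ) :
    |(H₁ w - H₂ w) - (H₁ w' - H₂ w') - (h₁ w - h₂ w) * (w - w')| ≤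
      (H₁ w' + H₂ w') - (H₁ w + H₂ w) + (h₁ w + h₂ w) * (w - w') := by
  rw [abs_le]
  constructor <;> linarith [H₁h₁ w w', H₂h₂ w w']

end IsSubgradient

lemma memLp_comp_of_lipschitzWith {α : Type*} [MeasurableSpace α] {μ : Measure α}
    [IsFiniteMeasure μ] {G : ℝ → ℝ} {Y : α → ℝ} {C : ℝ≥0} {p : ENNReal}
    (hG : LipschitzWith C G) (hY : MemLp Y p μ) : MemLp (fun x => G (Y x)) p μ := by
  have h0 : LipschitzWith C fun y => G y - G 0 := by
    simpa using hG.sub (LipschitzWith.const (G 0))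
  refine ((h0.comp_memLp (sub_self _) hY).add (memLp_const (G 0))).congr_norm
    (hG.continuous.comp_aestronglyMeasurable hY.1) (ae_of_all _ fun x => ?_)
  simp

section SteinSolution

variable {v : ℝ≥0} {t w : ℝ}

/-- The bounded solution of Stein's equation `v F' w - w F w = 1_{w ≤ t} - Φ(t)` for `N(0, v)`. -/
def steinSolution (v : ℝ≥0) (t w : ℝ) : ℝ :=
  if w ≤ t then (1 - cdf (gaussianReal 0 v) t) / v * mills v w
  else cdf (gaussianReal 0 v) t / v * mills v (-w)

/-- The derivative of `steinSolution v t`, extended to `t` by its left limit. -/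
def steinDeriv (v : ℝ≥0) (t w : ℝ) : ℝ :=
  if w ≤ t then (1 - cdf (gaussianReal 0 v) t) / v * millsDeriv v w
  else cdf (gaussianReal 0 v) t / v * -millsDeriv v (-w)

/-- The left derivative of `|· - t|`. -/
def leftSign (t w : ℝ) : ℝ := if w ≤ t then -1 else 1

lemma abs_leftSign (t w : ℝ) : |leftSign t w| = 1 := by
  unfold leftSign
  split_ifs <;> simp

lemma isSubgradient_abs_sub (t : ℝ) : IsSubgradient (fun w => |w - t|) (leftSign t) := by
  intro w w'
  unfold leftSign
  beta_reduce
  split_ifs with h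
  · rw [abs_of_nonpos (sub_nonpos.2 h)]
    linarith [neg_abs_le (w' - t)]
  · rw [abs_of_pos (sub_pos.2 (not_le.1 h))]
    linarith [le_abs_self (w' - t)]

lemma hasDerivAt_steinSolution (hv : v ≠ 0) (hw : w ≠ t) :
    HasDerivAt (steinSolution v t) (steinDeriv v t w) w := by
  rcases hw.lt_or_gt with h | h
  · rw [steinDeriv, if_pos h.le]
    refine ((hasDerivAt_mills hv w).const_mul _).congr_of_eventuallyEq ?_
    filter_upwards [Iio_mem_nhds h] with x (hx : x < t) using if_pos hx.le
  · rw [steinDeriv, if_neg (not_le.2 h)]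
    have hneg : HasDerivAt (fun x => mills v (-x)) (-millsDeriv v (-w)) w := by
      simpa [Function.comp_def] using (hasDerivAt_mills hv (-w)).scomp w (hasDerivAt_neg w)
    refine (hneg.const_mul _).congr_of_eventuallyEq ?_
    filter_upwards [Ioi_mem_nhds h] with x (hx : t < x) using if_neg (not_le.2 hx)

lemma steinSolution_eq (hv : v ≠ 0) (t w : ℝ) :
    v * steinDeriv v t w - w * steinSolution v t w =
      (Iic t).indicator 1 w - cdf (gaussianReal 0 v) t := by
  have hv' : (v : ℝ) ≠ 0 := NNReal.coe_ne_zero.2 hv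
  by_cases h : w ≤ t <;>
    simp only [steinDeriv, steinSolution, millsDeriv, indicator, mem_Iic, h, if_true, if_false,
      Pi.one_apply] <;>
    field_simp <;> ring

/-- Across `t` the slope of `steinSolution v t` drops by `1 / v`, which is exactly what
`|· - t| / (2 v)` compensates. -/
lemma isSubgradient_steinSolution_add (hv : v ≠ 0) (t : ℝ) :
    IsSubgradient (fun w => steinSolution v t w + 1 / (2 * v) * |w - t|)
      fun w => steinDeriv v t w + 1 / (2 * v) * leftSign t w := by
  have hv' : (0 : ℝ) < v := by positivity
  set c := cdf (gaussianReal 0 v) t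
  have hM : IsSubgradient (mills v) (millsDeriv v) :=
    .of_hasDerivAt (hasDerivAt_mills hv) (monotone_millsDeriv hv)
  have left := (hM.const_mul (a := (1 - c) / v)
    (div_nonneg (sub_nonneg.2 (cdf_le_one _ t)) hv'.le)).add
    (.linear (-(1 / (2 * v))) (t / (2 * v)))
  have right := (hM.comp_neg.const_mul (a := c / v) (div_nonneg (cdf_nonneg _ t) hv'.le)).add
    (.linear (1 / (2 * v)) (-(t / (2 * v))))
  have hswap := one_sub_cdf_mul_mills hv t
  convert left.ite right (t := t) ?_ ?_ using 2 with w w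
  · unfold steinSolution
    split_ifs with h
    · rw [abs_of_nonpos (sub_nonpos.2 h)]; ring
    · rw [abs_of_pos (sub_pos.2 (not_le.1 h))]; ring
  · unfold steinDeriv leftSign
    split_ifs <;> ring
  · linear_combination (1 / v) * hswap
  · refine le_of_eq ?_
    simp only [millsDeriv]
    field_simp
    linear_combination 2 * t * hswap

lemma abs_steinDeriv_add_le (hv : v ≠ 0) (t w : ℝ) :
    |steinDeriv v t w + 1 / (2 * v) * leftSign t w| ≤ 1 / (2 * v) := by
  have hmono := (isSubgradient_steinSolution_add hv t).monotone
  have hc := cdf_nonneg (gaussianReal 0 v) t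
  have hc' := cdf_le_one (gaussianReal 0 v) t
  rw [abs_le]
  constructor
  · refine le_trans ?_ (hmono (min_le_left w t))
    have := mul_nonneg (div_nonneg (sub_nonneg.2 hc') v.coe_nonneg) (millsDeriv_nonneg hv (min w t))
    simp only [steinDeriv, leftSign, min_le_right, if_true]
    linarith
  · refine (hmono ((le_max_left w t).trans (lt_add_one _).le)).trans ?_
    have := mul_nonneg (div_nonneg hc v.coe_nonneg) (millsDeriv_nonneg hv (-(max w t + 1)))
    have h : ¬ max w t + 1 ≤ t := not_le.2 ((le_max_right w t).trans_lt (lt_add_one _))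
    simp only [steinDeriv, leftSign, h, if_false]
    linarith

/-- `H₁ - H₂` is a difference of convex functions, `h₁ - h₂` its derivative, and it solves Stein's
equation of `N(0, K)` for the indicator of `(-∞, t]`, averaged over a Gaussian noise of variance
`c`; for `c = 0` there is no noise. -/
structure IsSteinSolution (c K : ℝ≥0) (t : ℝ) (H₁ h₁ H₂ h₂ : ℝ → ℝ) : Prop where
  isSubgradient₁ : IsSubgradient H₁ h₁
  isSubgradient₂ : IsSubgradient H₂ h₂
  abs_le₁ : ∀ y, |h₁ y| ≤ 1 / (2 * K)
  abs_le₂ : ∀ y, |h₂ y| ≤ 1 / (2 * K)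
  stein_eq : ∀ y, ((K : ℝ) - c) * (h₁ y - h₂ y) - y * (H₁ y - H₂ y) =
    cdf (gaussianReal 0 c) (t - y) - cdf (gaussianReal 0 K) t

namespace IsSteinSolution

variable {c K : ℝ≥0} {t : ℝ} {H₁ h₁ H₂ h₂ : ℝ → ℝ}

lemma abs_sub_le (hS : IsSteinSolution c K t H₁ h₁ H₂ h₂) (y : ℝ) : |h₁ y - h₂ y| ≤ 1 / K := by
  have h : (1 : ℝ) / K = 1 / (2 * K) + 1 / (2 * K) := by ring
  rw [h]
  exact (abs_sub _ _).trans (add_le_add (hS.abs_le₁ y) (hS.abs_le₂ y))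

lemma abs_add_le (hS : IsSteinSolution c K t H₁ h₁ H₂ h₂) (y : ℝ) : |h₁ y + h₂ y| ≤ 1 / K := by
  have h : (1 : ℝ) / K = 1 / (2 * K) + 1 / (2 * K) := by ring
  rw [h]
  exact (_root_.abs_add_le _ _).trans (add_le_add (hS.abs_le₁ y) (hS.abs_le₂ y))

end IsSteinSolution

lemma isSteinSolution_zero {v : ℝ≥0} (hv : v ≠ 0) (t : ℝ) :
    IsSteinSolution 0 v t (fun w => steinSolution v t w + 1 / (2 * v) * |w - t|)
      (fun w => steinDeriv v t w + 1 / (2 * v) * leftSign t w)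
      (fun w => 1 / (2 * v) * |w - t|) fun w => 1 / (2 * v) * leftSign t w where
  isSubgradient₁ := isSubgradient_steinSolution_add hv t
  isSubgradient₂ := (isSubgradient_abs_sub t).const_mul (by positivity)
  abs_le₁ := abs_steinDeriv_add_le hv t
  abs_le₂ w := by rw [abs_mul, abs_leftSign, mul_one, abs_of_nonneg (by positivity)]
  stein_eq w := by
    have hind : cdf (gaussianReal 0 0) (t - w) = (Iic t).indicator (1 : ℝ → ℝ) w := by
      rw [gaussianReal_zero_var, cdf_eq_real, measureReal_def,
        Measure.dirac_apply' _ measurableSet_Iic]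
      by_cases h : w ≤ t <;> simp [h]
    rw [hind, ← steinSolution_eq hv]
    simp

lemma integrable_comp_add_of_abs_le {ν : Measure ℝ} [IsFiniteMeasure ν] {h : ℝ → ℝ} {C : ℝ}
    (hm : Measurable h) (hC : ∀ w, |h w| ≤ C) (y : ℝ) : Integrable (fun b => h (b + y)) ν :=
  .of_bound (hm.comp (measurable_add_const y)).aestronglyMeasurable C (ae_of_all _ fun _ => hC _)

lemma memLp_comp_add_gaussianReal {m : ℝ} {c : ℝ≥0} {H : ℝ → ℝ} {C : ℝ≥0}
    (hH : LipschitzWith C H) (y : ℝ) : MemLp (fun b => H (b + y)) 2 (gaussianReal m c) :=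
  memLp_comp_of_lipschitzWith hH ((memLp_id_gaussianReal 2).add (memLp_const y))

lemma abs_integral_comp_add_le {ν : Measure ℝ} [IsProbabilityMeasure ν] {h : ℝ → ℝ} {C : ℝ}
    (hC : ∀ w, |h w| ≤ C) (y : ℝ) : |∫ b, h (b + y) ∂ν| ≤ C := by
  simpa using norm_integral_le_of_norm_le_const (μ := ν) (f := fun b => h (b + y)) (C := C)
    (ae_of_all _ fun _ => hC _)

lemma integral_id_mul_comp_add_gaussianReal {c : ℝ≥0} {G G' : ℝ → ℝ} {C : ℝ≥0} {D : ℝ}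
    (hG : LipschitzWith C G) (hd : ∀ x ≠ t, HasDerivAt G (G' x) x) (hG'm : Measurable G')
    (hG' : ∀ x, |G' x| ≤ D) (y : ℝ) :
    ∫ b, b * G (b + y) ∂gaussianReal 0 c = c * ∫ b, G' (b + y) ∂gaussianReal 0 c := by
  have hGL2 : MemLp (fun b => G (b + y)) 2 (gaussianReal 0 c) := memLp_comp_add_gaussianReal hG y
  have ibG : Integrable (fun b => b * G (b + y)) (gaussianReal 0 c) :=
    MemLp.integrable_mul (p := 2) (q := 2) (memLp_id_gaussianReal 2) hGL2
  simpa using integral_sub_mul_gaussianReal_eq (m := 0) (a := t - y)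
    (hG.continuous.comp (continuous_add_const y))
    (fun x hx => (hd (x + y) fun h => hx (by linarith)).comp_add_const x y)
    (hGL2.integrable one_le_two) (by simpa using ibG)
    (integrable_comp_add_of_abs_le hG'm hG' y)

lemma measurable_steinDeriv (hv : v ≠ 0) (t : ℝ) : Measurable (steinDeriv v t) := by
  have hS := isSteinSolution_zero hv t
  simpa [Pi.sub_def] using
    hS.isSubgradient₁.monotone.measurable.sub hS.isSubgradient₂.monotone.measurable

lemma abs_steinDeriv_le (hv : v ≠ 0) (t w : ℝ) : |steinDeriv v t w| ≤ 1 / v := by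
  simpa using (isSteinSolution_zero hv t).abs_sub_le w

lemma lipschitzWith_steinSolution (hv : v ≠ 0) (t : ℝ) :
    LipschitzWith ((1 / (2 * v) : ℝ).toNNReal + (1 / (2 * v) : ℝ).toNNReal)
      (steinSolution v t) := by
  have hS := isSteinSolution_zero hv t
  simpa only [add_sub_cancel_right] using
    (hS.isSubgradient₁.lipschitzWith hS.abs_le₁).sub (hS.isSubgradient₂.lipschitzWith hS.abs_le₂)

/-- Stein's equation averaged over the noise: Gaussian integration by parts trades the factor `b`
in `(b + y) F (b + y)` for the variance of the noise. -/
lemma integral_steinSolution_eq {K : ℝ≥0} (hK : K ≠ 0) (c : ℝ≥0) (t y : ℝ) :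
    ((K : ℝ) - c) * ∫ b, steinDeriv K t (b + y) ∂gaussianReal 0 c -
        y * ∫ b, steinSolution K t (b + y) ∂gaussianReal 0 c =
      cdf (gaussianReal 0 c) (t - y) - cdf (gaussianReal 0 K) t := by
  set ν := gaussianReal 0 c
  set F := steinSolution K t
  set F' := steinDeriv K t
  have iF' : Integrable (fun b => F' (b + y)) ν :=
    integrable_comp_add_of_abs_le (measurable_steinDeriv hK t) (abs_steinDeriv_le hK t) y
  have hF : MemLp (fun b => F (b + y)) 2 ν :=
    memLp_comp_add_gaussianReal (lipschitzWith_steinSolution hK t) y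
  have iF := hF.integrable one_le_two
  have ibF : Integrable (fun b => b * F (b + y)) ν :=
    MemLp.integrable_mul (p := 2) (q := 2) (memLp_id_gaussianReal 2) hF
  have hind : ∫ b, ((Iic t).indicator 1 (b + y) : ℝ) ∂ν = cdf ν (t - y) := by
    have : (fun b => (Iic t).indicator (1 : ℝ → ℝ) (b + y)) = (Iic (t - y)).indicator 1 := by
      funext b
      simp [indicator, le_sub_iff_add_le]
    rw [this, integral_indicator_one measurableSet_Iic, cdf_eq_real]
  have hpoint : ∀ b, ((Iic t).indicator 1 (b + y) : ℝ) =
      K * F' (b + y) - (b * F (b + y) + y * F (b + y)) + cdf (gaussianReal 0 K) t := fun b => by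
    linarith [steinSolution_eq hK t (b + y)]
  have i2 : Integrable (fun b => b * F (b + y) + y * F (b + y)) ν := ibF.add (iF.const_mul y)
  have i3 : Integrable (fun b => K * F' (b + y) - (b * F (b + y) + y * F (b + y))) ν :=
    (iF'.const_mul _).sub i2
  simp_rw [← hind, hpoint]
  rw [integral_add i3 (integrable_const _), integral_sub (iF'.const_mul _) i2,
    integral_add ibF (iF.const_mul y), integral_id_mul_comp_add_gaussianReal
      (lipschitzWith_steinSolution hK t) (fun x => hasDerivAt_steinSolution hK)
      (measurable_steinDeriv hK t) (abs_steinDeriv_le hK t)]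
  simp only [integral_const_mul, integral_const, probReal_univ, one_smul]
  ring

theorem exists_isSteinSolution (c : ℝ≥0) {K : ℝ≥0} (hK : K ≠ 0) (t : ℝ) :
    ∃ H₁ h₁ H₂ h₂, IsSteinSolution c K t H₁ h₁ H₂ h₂ := by
  have hS := isSteinSolution_zero hK t
  have hmeas₁ := hS.isSubgradient₁.monotone.measurable
  have hmeas₂ := hS.isSubgradient₂.monotone.measurable
  have ih₁ := integrable_comp_add_of_abs_le (ν := gaussianReal 0 c) hmeas₁ hS.abs_le₁
  have ih₂ := integrable_comp_add_of_abs_le (ν := gaussianReal 0 c) hmeas₂ hS.abs_le₂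
  have iH₁ := fun y => (memLp_comp_add_gaussianReal (m := 0) (c := c)
    (hS.isSubgradient₁.lipschitzWith hS.abs_le₁) y).integrable one_le_two
  have iH₂ := fun y => (memLp_comp_add_gaussianReal (m := 0) (c := c)
    (hS.isSubgradient₂.lipschitzWith hS.abs_le₂) y).integrable one_le_two
  refine ⟨_, _, _, _, hS.isSubgradient₁.integral_comp_add iH₁ ih₁,
    hS.isSubgradient₂.integral_comp_add iH₂ ih₂, abs_integral_comp_add_le hS.abs_le₁,
    abs_integral_comp_add_le hS.abs_le₂, fun y => ?_⟩
  rw [← integral_sub (iH₁ y) (iH₂ y), ← integral_sub (ih₁ y) (ih₂ y)]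
  simp only [add_sub_cancel_right]
  exact integral_steinSolution_eq hK c t y

end SteinSolution

section ResampleSum

variable {k : ℕ}

/-- The weighted sum `∑_{A ⊊ [k]} 1 / (C(k,|A|) (k - |A|)) ∑_{j ∉ A} a_{A,j}` that occurs in
`steinT` and `steinT'`. -/
def resampleSum (a : Finset (Fin k) → Fin k → ℝ) : ℝ :=
  ∑ A ∈ (Finset.univ : Finset (Fin k)).ssubsets,
    1 / ((k.choose A.card : ℝ) * ((k : ℝ) - (A.card : ℝ))) * ∑ j ∈ Aᶜ, a A j

lemma card_le_of_finset_fin (A : Finset (Fin k)) : A.card ≤ k := by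
  simpa using Finset.card_le_univ A

lemma ssubsets_univ_eq_erase :
    (Finset.univ : Finset (Fin k)).ssubsets = Finset.univ.erase Finset.univ := by
  ext A
  simp [Finset.ssubset_univ_iff]

lemma resampleSum_fst (a : Finset (Fin k) → ℝ) :
    resampleSum (fun A _ => a A) = ∑ A, a A / k.choose A.card - a Finset.univ := by
  have huniv : a Finset.univ = a Finset.univ / k.choose (Finset.univ : Finset (Fin k)).card := by
    simp
  rw [huniv, ← Finset.sum_erase_eq_sub (Finset.mem_univ _), resampleSum, ssubsets_univ_eq_erase]
  refine Finset.sum_congr rfl fun A hA => ?_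
  have hlt : A.card < k := (card_le_of_finset_fin A).lt_of_ne fun h =>
    Finset.ne_of_mem_erase hA ((Finset.card_eq_iff_eq_univ A).1 (by simpa using h))
  have hsub : (k : ℝ) - A.card ≠ 0 := sub_ne_zero.2 (by exact_mod_cast hlt.ne')
  have hchoose : (k.choose A.card : ℝ) ≠ 0 := by exact_mod_cast (Nat.choose_pos hlt.le).ne'
  rw [Finset.sum_const, Finset.card_compl, Fintype.card_fin, nsmul_eq_mul,
    Nat.cast_sub hlt.le]
  field_simp

lemma sum_sum_compl_insert (b : Finset (Fin k) → Fin k → ℝ) :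
    ∑ A : Finset (Fin k), ∑ j ∈ Aᶜ, b (insert j A) j = ∑ B : Finset (Fin k), ∑ j ∈ B, b B j := by
  rw [Finset.sum_sigma', Finset.sum_sigma']
  refine Finset.sum_bij' (fun p _ => ⟨insert p.2 p.1, p.2⟩) (fun p _ => ⟨p.1.erase p.2, p.2⟩)
    (by simp) (by simp) ?_ ?_ (by simp)
  · rintro ⟨A, j⟩ h
    have hj : j ∉ A := by simpa using h
    simp [Finset.erase_insert hj]
  · rintro ⟨B, j⟩ h
    have hj : j ∈ B := by simpa using h
    simp [Finset.insert_erase hj]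

lemma choose_mul_sub_eq_of_mem {B : Finset (Fin k)} {j : Fin k} (hj : j ∈ B) :
    (k.choose (B.erase j).card : ℝ) * ((k : ℝ) - (B.erase j).card) =
      k.choose B.card * B.card := by
  obtain ⟨n, hn⟩ : ∃ n, B.card = n + 1 :=
    Nat.exists_eq_succ_of_ne_zero (Finset.card_ne_zero_of_mem hj)
  have hnk : n ≤ k := by have := card_le_of_finset_fin B; omega
  rw [Finset.card_erase_of_mem hj, hn, Nat.add_sub_cancel, ← Nat.cast_sub hnk]
  exact_mod_cast (Nat.choose_succ_right_eq k n).symm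

lemma resampleSum_insert (a : Finset (Fin k) → ℝ) :
    resampleSum (fun A j => a (insert j A)) = ∑ A, a A / k.choose A.card - a ∅ := by
  have hempty : a ∅ = a ∅ / k.choose (∅ : Finset (Fin k)).card := by simp
  calc resampleSum (fun A j => a (insert j A)) =
        ∑ A : Finset (Fin k), ∑ j ∈ Aᶜ,
          1 / ((k.choose A.card : ℝ) * ((k : ℝ) - (A.card : ℝ))) * a (insert j A) := by
        rw [← Finset.add_sum_erase Finset.univ _ (Finset.mem_univ Finset.univ), resampleSum,
          ssubsets_univ_eq_erase]
        simp [Finset.mul_sum]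
    _ = ∑ A : Finset (Fin k), ∑ j ∈ Aᶜ, 1 / ((k.choose ((insert j A).erase j).card : ℝ) *
          ((k : ℝ) - ((insert j A).erase j).card)) * a (insert j A) :=
        Finset.sum_congr rfl fun A _ => Finset.sum_congr rfl fun j hj => by
          rw [Finset.erase_insert (Finset.mem_compl.1 hj)]
    _ = ∑ B : Finset (Fin k), ∑ j ∈ B,
          1 / ((k.choose (B.erase j).card : ℝ) * ((k : ℝ) - (B.erase j).card)) * a B :=
        sum_sum_compl_insert fun B j =>
          1 / ((k.choose (B.erase j).card : ℝ) * ((k : ℝ) - (B.erase j).card)) * a B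
    _ = ∑ B : Finset (Fin k), ∑ _j ∈ B, 1 / (k.choose B.card * B.card : ℝ) * a B :=
        Finset.sum_congr rfl fun B _ => Finset.sum_congr rfl fun j hj => by
          rw [choose_mul_sub_eq_of_mem hj]
    _ = ∑ A, a A / k.choose A.card - a ∅ := by
        rw [hempty, ← Finset.sum_erase_eq_sub (Finset.mem_univ _),
          ← Finset.add_sum_erase Finset.univ _ (Finset.mem_univ (∅ : Finset (Fin k))),
          Finset.sum_empty, zero_add]
        refine Finset.sum_congr rfl fun B hB => ?_
        have hB0 : (B.card : ℝ) ≠ 0 := by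
          exact_mod_cast Finset.card_ne_zero.2
            (Finset.nonempty_iff_ne_empty.2 (Finset.ne_of_mem_erase hB))
        rw [Finset.sum_const, nsmul_eq_mul]
        field_simp

lemma resampleSum_sub (a a' : Finset (Fin k) → Fin k → ℝ) :
    resampleSum (fun A j => a A j - a' A j) = resampleSum a - resampleSum a' := by
  simp only [resampleSum, Finset.sum_sub_distrib, mul_sub]

lemma mul_resampleSum (c : ℝ) (a : Finset (Fin k) → Fin k → ℝ) :
    c * resampleSum a = resampleSum fun A j => c * a A j := by
  simp only [resampleSum, Finset.mul_sum, mul_left_comm c]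

lemma resampleSum_sub_insert (a : Finset (Fin k) → ℝ) :
    resampleSum (fun A j => a A - a (insert j A)) = a ∅ - a Finset.univ := by
  rw [resampleSum_sub, resampleSum_fst, resampleSum_insert]
  ring

lemma resampleSum_mono {a a' : Finset (Fin k) → Fin k → ℝ} (h : ∀ A, ∀ j ∉ A, a A j ≤ a' A j) :
    resampleSum a ≤ resampleSum a' := by
  refine Finset.sum_le_sum fun A _ => mul_le_mul_of_nonneg_left
    (Finset.sum_le_sum fun j hj => h A j (Finset.mem_compl.1 hj)) ?_
  exact one_div_nonneg.2 (mul_nonneg (Nat.cast_nonneg _)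
    (sub_nonneg.2 (by exact_mod_cast card_le_of_finset_fin A)))

lemma resampleSum_congr {a a' : Finset (Fin k) → Fin k → ℝ} (h : ∀ A, ∀ j ∉ A, a A j = a' A j) :
    resampleSum a = resampleSum a' :=
  le_antisymm (resampleSum_mono fun A j hj => (h A j hj).le)
    (resampleSum_mono fun A j hj => (h A j hj).ge)

lemma resampleSum_const (c : Fin k → ℝ) : resampleSum (fun _ j => c j) = ∑ j, c j := by
  have h := resampleSum_sub_insert fun A : Finset (Fin k) => -∑ j ∈ A, c j
  rw [Finset.sum_empty, neg_zero, zero_sub, neg_neg] at h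
  rw [← h]
  refine resampleSum_congr fun A j hj => ?_
  rw [Finset.sum_insert hj]
  ring

lemma abs_resampleSum_le (a : Finset (Fin k) → Fin k → ℝ) :
    |resampleSum a| ≤ resampleSum fun A j => |a A j| := by
  refine abs_le'.2 ⟨resampleSum_mono fun A j _ => le_abs_self _, ?_⟩
  rw [← neg_one_mul, mul_resampleSum]
  exact resampleSum_mono fun A j _ => by rw [neg_one_mul]; exact neg_le_abs _

variable {Ω : Type*} [MeasurableSpace Ω] {P : Measure Ω} {a : Finset (Fin k) → Fin k → Ω → ℝ}

lemma integral_resampleSum (ha : ∀ A j, Integrable (a A j) P) :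
    ∫ ω, resampleSum (fun A j => a A j ω) ∂P = resampleSum fun A j => ∫ ω, a A j ω ∂P := by
  simp only [resampleSum]
  rw [integral_finsetSum _ fun A _ => (integrable_finsetSum _ fun j _ => ha A j).const_mul _]
  refine Finset.sum_congr rfl fun A _ => ?_
  rw [integral_const_mul, integral_finsetSum _ fun j _ => ha A j]

lemma memLp_resampleSum {p : ENNReal} (ha : ∀ A j, MemLp (a A j) p P) :
    MemLp (fun ω => resampleSum fun A j => a A j ω) p P :=
  memLp_finsetSum _ fun A _ => (memLp_finsetSum _ fun j _ => ha A j).const_mul _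

lemma integral_mul_resampleSum {u : Ω → ℝ} (c : ℝ)
    (ha : ∀ A j, Integrable (fun ω => u ω * a A j ω) P) :
    ∫ ω, u ω * (c * resampleSum fun A j => a A j ω) ∂P =
      c * resampleSum fun A j => ∫ ω, u ω * a A j ω ∂P := by
  rw [← integral_resampleSum ha, ← integral_const_mul]
  refine integral_congr_ae (ae_of_all _ fun ω => ?_)
  simp only [← mul_resampleSum]
  ring

end ResampleSum

section Resampling

variable {E : Type*} {k : ℕ}

/-- The exchange of the coordinates in `A` between the two vectors of a pair. -/
def swapOn (A : Finset (Fin k)) (p : (Fin k → E) × (Fin k → E)) : (Fin k → E) × (Fin k → E) :=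
  (resample p.1 p.2 A, resample p.2 p.1 A)

@[simp]
lemma resample_empty (x x' : Fin k → E) : resample x x' ∅ = x := by
  funext i; simp [resample]

@[simp]
lemma resample_univ (x x' : Fin k → E) : resample x x' Finset.univ = x' := by
  funext i; simp [resample]

lemma resample_swapOn_singleton {A : Finset (Fin k)} {j : Fin k} (hj : j ∉ A)
    (p : (Fin k → E) × (Fin k → E)) :
    resample (swapOn {j} p).1 (swapOn {j} p).2 A = resample p.1 p.2 (insert j A) := by
  funext i
  rcases eq_or_ne i j with rfl | h <;> simp [swapOn, resample, *]

lemma resample_swapOn_singleton_insert {A : Finset (Fin k)} {j : Fin k} (hj : j ∉ A)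
    (p : (Fin k → E) × (Fin k → E)) :
    resample (swapOn {j} p).1 (swapOn {j} p).2 (insert j A) = resample p.1 p.2 A := by
  funext i
  rcases eq_or_ne i j with rfl | h <;> simp [swapOn, resample, *]

lemma resampleDiff_empty (f : (Fin k → E) → ℝ) (j : Fin k) (p : (Fin k → E) × (Fin k → E)) :
    resampleDiff f j ∅ p.1 p.2 = f p.1 - f (swapOn {j} p).1 := by
  simp [resampleDiff, swapOn]

lemma resampleDiff_swapOn_singleton (f : (Fin k → E) → ℝ) {A : Finset (Fin k)} {j : Fin k}
    (hj : j ∉ A) (p : (Fin k → E) × (Fin k → E)) :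
    resampleDiff f j A (swapOn {j} p).1 (swapOn {j} p).2 = -resampleDiff f j A p.1 p.2 := by
  rw [resampleDiff, resampleDiff, resample_swapOn_singleton hj,
    resample_swapOn_singleton_insert hj, neg_sub]

lemma steinT_eq_resampleSum (f : (Fin k → E) → ℝ) (x x' : Fin k → E) :
    steinT f x x' =
      1 / 2 * resampleSum fun A j => resampleDiff f j ∅ x x' * resampleDiff f j A x x' := rfl

lemma steinT'_eq_resampleSum (f : (Fin k → E) → ℝ) (x x' : Fin k → E) :
    steinT' f x x' =
      1 / 2 * resampleSum fun A j => resampleDiff f j ∅ x x' * |resampleDiff f j A x x'| := rfl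

variable [MeasurableSpace E] (μ : Fin k → Measure E)

/-- The joint law of two independent vectors which both have independent coordinates with
laws `μ i`. -/
abbrev pairLaw : Measure ((Fin k → E) × (Fin k → E)) := (Measure.pi μ).prod (Measure.pi μ)

variable [∀ i, IsProbabilityMeasure (μ i)] {f : (Fin k → E) → ℝ} {q : ENNReal}

lemma measurePreserving_swapOn (A : Finset (Fin k)) :
    MeasurePreserving (swapOn A) (pairLaw μ) (pairLaw μ) := by
  have coords := measurePreserving_arrowProdEquivProdArrow E E (Fin k) μ μ
  have swap : MeasurePreserving
      (fun (a : Fin k → E × E) i => (if i ∈ A then Prod.swap else id) (a i))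
      (.pi fun i => (μ i).prod (μ i)) (.pi fun i => (μ i).prod (μ i)) := by
    refine measurePreserving_pi _ _ (f := fun i => if i ∈ A then Prod.swap else id) fun i => ?_
    split_ifs
    · exact Measure.measurePreserving_swap
    · exact MeasurePreserving.id _
  convert (coords.comp swap).comp (coords.symm _) using 1
  funext p
  ext i <;>
  · by_cases h : i ∈ A <;>
    simp [swapOn, resample, MeasurableEquiv.arrowProdEquivProdArrow,
      Equiv.arrowProdEquivProdArrow, h]

lemma memLp_comp_resample (hf : MemLp f q (Measure.pi μ)) (A : Finset (Fin k)) :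
    MemLp (fun p : (Fin k → E) × (Fin k → E) => f (resample p.1 p.2 A)) q (pairLaw μ) :=
  hf.comp_measurePreserving (measurePreserving_fst.comp (measurePreserving_swapOn μ A))

lemma memLp_resampleDiff (hf : MemLp f q (Measure.pi μ)) (j : Fin k) (A : Finset (Fin k)) :
    MemLp (fun p : (Fin k → E) × (Fin k → E) => resampleDiff f j A p.1 p.2) q (pairLaw μ) :=
  (memLp_comp_resample μ hf A).sub (memLp_comp_resample μ hf (insert j A))

lemma memLp_two_mul {Ω : Type*} [MeasurableSpace Ω] {P : Measure Ω} {Y Z : Ω → ℝ}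
    (hY : MemLp Y 4 P) (hZ : MemLp Z 4 P) : MemLp (fun ω => Y ω * Z ω) 2 P := by
  have : ENNReal.HolderTriple 4 4 2 := ⟨by
    rw [← two_mul, show (4 : ENNReal) = 2 * 2 by norm_num,
      ENNReal.mul_inv (Or.inl two_ne_zero) (Or.inl ENNReal.ofNat_ne_top), ← mul_assoc,
      ENNReal.mul_inv_cancel two_ne_zero ENNReal.ofNat_ne_top, one_mul]⟩
  exact hZ.mul hY

lemma memLp_steinT (hf : MemLp f 4 (Measure.pi μ)) :
    MemLp (fun p : (Fin k → E) × (Fin k → E) => steinT f p.1 p.2) 2 (pairLaw μ) :=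
  (memLp_resampleSum fun A j => memLp_two_mul (memLp_resampleDiff μ hf j ∅)
    (memLp_resampleDiff μ hf j A)).const_mul _

lemma memLp_steinT' (hf : MemLp f 4 (Measure.pi μ)) :
    MemLp (fun p : (Fin k → E) × (Fin k → E) => steinT' f p.1 p.2) 2 (pairLaw μ) :=
  (memLp_resampleSum fun A j => memLp_two_mul (memLp_resampleDiff μ hf j ∅)
    (memLp_resampleDiff μ hf j A).abs).const_mul _

lemma integrable_steinT (hf : MemLp f 2 (Measure.pi μ)) :
    Integrable (fun p : (Fin k → E) × (Fin k → E) => steinT f p.1 p.2) (pairLaw μ) :=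
  memLp_one_iff_integrable.1 <| (memLp_resampleSum fun A j => memLp_one_iff_integrable.2 <|
    (memLp_resampleDiff μ hf j ∅).integrable_mul (memLp_resampleDiff μ hf j A)).const_mul _

lemma integral_eq_zero_of_comp_eq_neg {α : Type*} [MeasurableSpace α] {ρ : Measure α} {s : α → α}
    (hs : MeasurePreserving s ρ ρ) {V : α → ℝ} (hV : AEStronglyMeasurable V ρ)
    (hVs : ∀ p, V (s p) = -V p) : ∫ p, V p ∂ρ = 0 := by
  have h := hs.hasLaw.integral_comp hV
  simp only [Function.comp_apply, hVs, integral_neg] at h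
  linarith

lemma integral_steinT'_eq_zero (hf : MemLp f 2 (Measure.pi μ)) :
    ∫ p, steinT' f p.1 p.2 ∂pairLaw μ = 0 := by
  have hi : ∀ A j, Integrable (fun p : (Fin k → E) × (Fin k → E) =>
      resampleDiff f j ∅ p.1 p.2 * |resampleDiff f j A p.1 p.2|) (pairLaw μ) := fun A j =>
    (memLp_resampleDiff μ hf j ∅).integrable_mul (memLp_resampleDiff μ hf j A).abs
  simp only [steinT'_eq_resampleSum]
  rw [integral_const_mul, integral_resampleSum hi,
    resampleSum_congr (a' := fun _ _ => 0) fun A j hj => ?_, resampleSum_const]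
  · simp
  · exact integral_eq_zero_of_comp_eq_neg (measurePreserving_swapOn μ {j})
      (hi A j).aestronglyMeasurable fun p => by
        rw [resampleDiff_swapOn_singleton f hj,
          resampleDiff_swapOn_singleton f (Finset.notMem_empty j), abs_neg, neg_mul]

/-- Chatterjee's covariance identity. -/
lemma integral_mul_eq_resampleSum {h : (Fin k → E) → ℝ} (hh : MemLp h 2 (Measure.pi μ))
    (hf : MemLp f 2 (Measure.pi μ)) (h0 : ∫ x, f x ∂Measure.pi μ = 0) :
    ∫ p, h p.1 * f p.1 ∂pairLaw μ =
      resampleSum fun A j => ∫ p, h p.1 * resampleDiff f j A p.1 p.2 ∂pairLaw μ := by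
  have hi : ∀ A : Finset (Fin k), Integrable (fun p : (Fin k → E) × (Fin k → E) =>
      h p.1 * f (resample p.1 p.2 A)) (pairLaw μ) := fun A =>
    (hh.comp_measurePreserving measurePreserving_fst).integrable_mul (memLp_comp_resample μ hf A)
  have indep : ∫ p, h p.1 * f (resample p.1 p.2 Finset.univ) ∂pairLaw μ = 0 := by
    simp only [resample_univ]
    rw [integral_prod_mul, h0, mul_zero]
  calc ∫ p, h p.1 * f p.1 ∂pairLaw μ =
        ∫ p, h p.1 * f (resample p.1 p.2 ∅) ∂pairLaw μ -
          ∫ p, h p.1 * f (resample p.1 p.2 Finset.univ) ∂pairLaw μ := by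
        rw [indep]; simp
    _ = resampleSum fun A j => ∫ p, h p.1 * f (resample p.1 p.2 A) ∂pairLaw μ -
          ∫ p, h p.1 * f (resample p.1 p.2 (insert j A)) ∂pairLaw μ :=
        (resampleSum_sub_insert fun A => ∫ p, h p.1 * f (resample p.1 p.2 A) ∂pairLaw μ).symm
    _ = _ := resampleSum_congr fun A j _ => by
        rw [← integral_sub (hi A) (hi (insert j A))]
        simp only [resampleDiff, mul_sub]

end Resampling

section Exchangeable

variable {α : Type*} [MeasurableSpace α] {ρ : Measure α} {s : α → α} {U V Y D : α → ℝ}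
  {H₁ h₁ H₂ h₂ : ℝ → ℝ} {C : ℝ}

lemma integral_sub_comp_mul_of_comp_eq_neg (hs : MeasurePreserving s ρ ρ)
    (hUV : Integrable (fun p => U p * V p) ρ) (hVs : ∀ p, V (s p) = -V p) :
    Integrable (fun p => (U p - U (s p)) * V p) ρ ∧
      ∫ p, (U p - U (s p)) * V p ∂ρ = 2 * ∫ p, U p * V p ∂ρ := by
  have expand : (fun p => (U p - U (s p)) * V p) =
      fun p => U p * V p + U (s p) * V (s p) := by
    funext p; rw [hVs]; ring
  have hUVs : Integrable (fun p => U (s p) * V (s p)) ρ := hs.integrable_comp_of_integrable hUV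
  have hint : ∫ p, U (s p) * V (s p) ∂ρ = ∫ p, U p * V p ∂ρ :=
    hs.hasLaw.integral_comp hUV.aestronglyMeasurable
  rw [expand]
  exact ⟨hUV.add hUVs, by rw [integral_add hUV hUVs, hint, two_mul]⟩

lemma integral_comp_sub_mul_of_comp_eq (hs : MeasurePreserving s ρ ρ)
    (hUV : Integrable (fun p => U p * V p) ρ) (hVs : ∀ p, V (s p) = V p) :
    Integrable (fun p => (U (s p) - U p) * V p) ρ ∧ ∫ p, (U (s p) - U p) * V p ∂ρ = 0 := by
  have expand : (fun p => (U (s p) - U p) * V p) =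
      fun p => U (s p) * V (s p) - U p * V p := by
    funext p; rw [hVs]; ring
  have hUVs : Integrable (fun p => U (s p) * V (s p)) ρ := hs.integrable_comp_of_integrable hUV
  have hint : ∫ p, U (s p) * V (s p) ∂ρ = ∫ p, U p * V p ∂ρ :=
    hs.hasLaw.integral_comp hUV.aestronglyMeasurable
  rw [expand]
  exact ⟨hUVs.sub hUV, by rw [integral_sub hUVs hUV, hint, sub_self]⟩

lemma integrable_comp_mul_of_abs_le {u : ℝ → ℝ} (hu : Measurable u) (hC : ∀ y, |u y| ≤ C)
    (hY : AEMeasurable Y ρ) (hD : Integrable D ρ) : Integrable (fun p => u (Y p) * D p) ρ :=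
  hD.bdd_mul (hu.comp_aemeasurable hY).aestronglyMeasurable (ae_of_all _ fun p => hC (Y p))

/-- For an exchangeable pair `(Y, Y ∘ s)` the increments of `H₁ + H₂` against the symmetric
factor `|D|` integrate to zero, so that the Taylor remainder of `H₁ - H₂` is dominated by its
first order term. -/
lemma IsSubgradient.abs_two_mul_integral_sub_le [IsFiniteMeasure ρ] (sub₁ : IsSubgradient H₁ h₁)
    (sub₂ : IsSubgradient H₂ h₂) (le₁ : ∀ y, |h₁ y| ≤ C) (le₂ : ∀ y, |h₂ y| ≤ C)
    (hs : MeasurePreserving s ρ ρ) (hY : MemLp Y 2 ρ) (hD : MemLp D 2 ρ)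
    (hDs : ∀ p, D (s p) = -D p) :
    |2 * ∫ p, (H₁ (Y p) - H₂ (Y p)) * D p ∂ρ -
        ∫ p, (h₁ (Y p) - h₂ (Y p)) * ((Y p - Y (s p)) * D p) ∂ρ| ≤
      ∫ p, (h₁ (Y p) + h₂ (Y p)) * ((Y p - Y (s p)) * |D p|) ∂ρ := by
  have hD' : MemLp (fun p => |D p|) 2 ρ := hD.abs
  have hY' : MemLp (fun p => Y p - Y (s p)) 2 ρ := hY.sub (hY.comp_measurePreserving hs)
  have hH₁ := memLp_comp_of_lipschitzWith (sub₁.lipschitzWith le₁) hY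
  have hH₂ := memLp_comp_of_lipschitzWith (sub₂.lipschitzWith le₂) hY
  obtain ⟨iminus, eminus⟩ := integral_sub_comp_mul_of_comp_eq_neg hs
    ((hH₁.sub hH₂).integrable_mul hD) hDs
  obtain ⟨iplus, eplus⟩ := integral_comp_sub_mul_of_comp_eq hs
    ((hH₁.add hH₂).integrable_mul hD') fun p => by rw [hDs, abs_neg]
  have jminus := integrable_comp_mul_of_abs_le
    (sub₁.monotone.measurable.sub sub₂.monotone.measurable)
    (fun y => (abs_sub _ _).trans (add_le_add (le₁ y) (le₂ y))) hY.1.aemeasurable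
    (hY'.integrable_mul hD)
  have jplus := integrable_comp_mul_of_abs_le
    (sub₁.monotone.measurable.add sub₂.monotone.measurable)
    (fun y => (abs_add_le _ _).trans (add_le_add (le₁ y) (le₂ y))) hY.1.aemeasurable
    (hY'.integrable_mul hD')
  simp only [Pi.sub_apply, Pi.add_apply, Pi.mul_apply] at iminus eminus iplus eplus jminus jplus
  have eadd := integral_add iplus jplus
  rw [eplus, zero_add] at eadd
  rw [← eminus, ← integral_sub iminus jminus, ← eadd]
  rw [← Real.norm_eq_abs]
  refine norm_integral_le_of_norm_le (iplus.add jplus) (ae_of_all _ fun p => ?_)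
  have h := mul_le_mul_of_nonneg_right (sub₁.abs_taylor_sub_le sub₂ (Y p) (Y (s p)))
    (abs_nonneg (D p))
  rw [← abs_mul] at h
  rw [Real.norm_eq_abs]
  exact (congrArg abs (by ring)).trans_le (h.trans_eq (by ring))

end Exchangeable

section SteinBound

variable {E : Type*} {k : ℕ} [MeasurableSpace E] (μ : Fin k → Measure E)
  [∀ i, IsProbabilityMeasure (μ i)] {f : (Fin k → E) → ℝ} {H₁ h₁ H₂ h₂ : ℝ → ℝ}

lemma IsSubgradient.abs_integral_sub_le_steinT' (sub₁ : IsSubgradient H₁ h₁)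
    (sub₂ : IsSubgradient H₂ h₂) {C : ℝ} (le₁ : ∀ y, |h₁ y| ≤ C) (le₂ : ∀ y, |h₂ y| ≤ C)
    (hf : MemLp f 2 (Measure.pi μ)) (h0 : ∫ x, f x ∂Measure.pi μ = 0) :
    |∫ p, (H₁ (f p.1) - H₂ (f p.1)) * f p.1 ∂pairLaw μ -
        ∫ p, (h₁ (f p.1) - h₂ (f p.1)) * steinT f p.1 p.2 ∂pairLaw μ| ≤
      ∫ p, (h₁ (f p.1) + h₂ (f p.1)) * steinT' f p.1 p.2 ∂pairLaw μ := by
  have hf1 : MemLp (fun p : (Fin k → E) × (Fin k → E) => f p.1) 2 (pairLaw μ) :=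
    hf.comp_measurePreserving measurePreserving_fst
  have hD := memLp_resampleDiff μ hf
  have hDabs : ∀ j A, MemLp (fun p : (Fin k → E) × (Fin k → E) =>
      |resampleDiff f j A p.1 p.2|) 2 (pairLaw μ) := fun j A => (hD j A).abs
  have hHf := (memLp_comp_of_lipschitzWith (sub₁.lipschitzWith le₁) hf).sub
    (memLp_comp_of_lipschitzWith (sub₂.lipschitzWith le₂) hf)
  have iminus := fun A j => integrable_comp_mul_of_abs_le
    (sub₁.monotone.measurable.sub sub₂.monotone.measurable)
    (fun y => (abs_sub _ _).trans (add_le_add (le₁ y) (le₂ y))) hf1.1.aemeasurable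
    ((hD j ∅).integrable_mul (hD j A))
  have iplus := fun A j => integrable_comp_mul_of_abs_le
    (sub₁.monotone.measurable.add sub₂.monotone.measurable)
    (fun y => (abs_add_le _ _).trans (add_le_add (le₁ y) (le₂ y))) hf1.1.aemeasurable
    ((hD j ∅).integrable_mul (hDabs j A))
  have cov := integral_mul_eq_resampleSum μ hHf hf h0
  simp only [Pi.sub_apply, Pi.add_apply, Pi.mul_apply] at iminus iplus cov
  have hsum : ∫ p, (H₁ (f p.1) - H₂ (f p.1)) * f p.1 ∂pairLaw μ =
      1 / 2 * resampleSum fun A j =>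
        2 * ∫ p, (H₁ (f p.1) - H₂ (f p.1)) * resampleDiff f j A p.1 p.2 ∂pairLaw μ := by
    rw [cov, ← mul_resampleSum]; ring
  simp only [steinT_eq_resampleSum, steinT'_eq_resampleSum]
  rw [hsum, integral_mul_resampleSum _ iminus, integral_mul_resampleSum _ iplus, ← mul_sub,
    ← resampleSum_sub, abs_mul, abs_of_pos (one_half_pos (α := ℝ))]
  refine mul_le_mul_of_nonneg_left ((abs_resampleSum_le _).trans
    (resampleSum_mono fun A j hj => ?_)) one_half_pos.le
  simp only [resampleDiff_empty]
  exact sub₁.abs_two_mul_integral_sub_le sub₂ le₁ le₂ (measurePreserving_swapOn μ {j}) hf1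
    (hD j A) (resampleDiff_swapOn_singleton f hj)

lemma integrable_cdf_comp {α : Type*} [MeasurableSpace α] {ρ : Measure α} [IsFiniteMeasure ρ]
    {ν : Measure ℝ} {Y : α → ℝ} (hY : AEMeasurable Y ρ) : Integrable (fun x => cdf ν (Y x)) ρ :=
  Integrable.of_bound ((monotone_cdf ν).measurable.comp_aemeasurable hY).aestronglyMeasurable 1
    (ae_of_all _ fun x => by
      rw [Real.norm_eq_abs, abs_of_nonneg (cdf_nonneg ν _)]; exact cdf_le_one ν _)

lemma IsSteinSolution.integral_cdf_sub_eq {c K : ℝ≥0} {t : ℝ}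
    (hS : IsSteinSolution c K t H₁ h₁ H₂ h₂) (hf : MemLp f 2 (Measure.pi μ)) :
    ∫ x, cdf (gaussianReal 0 c) (t - f x) ∂Measure.pi μ - cdf (gaussianReal 0 K) t =
      ∫ p, (h₁ (f p.1) - h₂ (f p.1)) * ((K : ℝ) - c - steinT f p.1 p.2) ∂pairLaw μ -
        (∫ p, (H₁ (f p.1) - H₂ (f p.1)) * f p.1 ∂pairLaw μ -
          ∫ p, (h₁ (f p.1) - h₂ (f p.1)) * steinT f p.1 p.2 ∂pairLaw μ) := by
  have hf1 : MemLp (fun p : (Fin k → E) × (Fin k → E) => f p.1) 2 (pairLaw μ) :=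
    hf.comp_measurePreserving measurePreserving_fst
  have iF : Integrable (fun p : (Fin k → E) × (Fin k → E) =>
      (H₁ (f p.1) - H₂ (f p.1)) * f p.1) (pairLaw μ) :=
    ((memLp_comp_of_lipschitzWith (hS.isSubgradient₁.lipschitzWith hS.abs_le₁) hf1).sub
      (memLp_comp_of_lipschitzWith (hS.isSubgradient₂.lipschitzWith hS.abs_le₂) hf1)).integrable_mul
      hf1
  have iF' {V : (Fin k → E) × (Fin k → E) → ℝ} (hV : Integrable V (pairLaw μ)) :
      Integrable (fun p => (h₁ (f p.1) - h₂ (f p.1)) * V p) (pairLaw μ) :=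
    integrable_comp_mul_of_abs_le
      (hS.isSubgradient₁.monotone.measurable.sub hS.isSubgradient₂.monotone.measurable)
      hS.abs_sub_le hf1.1.aemeasurable hV
  have iT := integrable_steinT μ hf
  have icdf : Integrable (fun x => cdf (gaussianReal 0 c) (t - f x)) (Measure.pi μ) :=
    integrable_cdf_comp (hf.1.aemeasurable.const_sub t)
  have hfst : ∫ p, (cdf (gaussianReal 0 c) (t - f p.1) - cdf (gaussianReal 0 K) t) ∂pairLaw μ =
      ∫ x, cdf (gaussianReal 0 c) (t - f x) ∂Measure.pi μ - cdf (gaussianReal 0 K) t := by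
    rw [integral_sub (icdf.comp_fst _) (integrable_const _),
      integral_fun_fst fun x => cdf (gaussianReal 0 c) (t - f x)]
    simp
  have iKT : Integrable (fun p : (Fin k → E) × (Fin k → E) =>
      (K : ℝ) - c - steinT f p.1 p.2) (pairLaw μ) := (integrable_const _).sub iT
  have iFT : Integrable (fun p : (Fin k → E) × (Fin k → E) => (H₁ (f p.1) - H₂ (f p.1)) * f p.1 -
      (h₁ (f p.1) - h₂ (f p.1)) * steinT f p.1 p.2) (pairLaw μ) := iF.sub (iF' iT)
  rw [← hfst, ← integral_sub iF (iF' iT), ← integral_sub (iF' iKT) iFT]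
  refine integral_congr_ae (ae_of_all _ fun p => ?_)
  simp only
  rw [← hS.stein_eq]
  ring

theorem exists_abs_integral_cdf_sub_le (hf : MemLp f 2 (Measure.pi μ))
    (h0 : ∫ x, f x ∂Measure.pi μ = 0) (c : ℝ≥0) {K : ℝ≥0} (hK : K ≠ 0) (t : ℝ) :
    ∃ γ ψ : ℝ → ℝ, Measurable γ ∧ Measurable ψ ∧ (∀ y, |γ y| ≤ 1 / K) ∧ (∀ y, |ψ y| ≤ 1 / K) ∧
      |∫ x, cdf (gaussianReal 0 c) (t - f x) ∂Measure.pi μ - cdf (gaussianReal 0 K) t| ≤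
        |∫ p, γ (f p.1) * ((K : ℝ) - c - steinT f p.1 p.2) ∂pairLaw μ| +
          |∫ p, ψ (f p.1) * steinT' f p.1 p.2 ∂pairLaw μ| := by
  obtain ⟨H₁, h₁, H₂, h₂, hS⟩ := exists_isSteinSolution c hK t
  have hm₁ := hS.isSubgradient₁.monotone.measurable
  have hm₂ := hS.isSubgradient₂.monotone.measurable
  have hT' := hS.isSubgradient₁.abs_integral_sub_le_steinT' μ hS.isSubgradient₂ hS.abs_le₁
    hS.abs_le₂ hf h0
  refine ⟨_, _, hm₁.sub hm₂, hm₁.add hm₂, hS.abs_sub_le, hS.abs_add_le, ?_⟩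
  rw [hS.integral_cdf_sub_eq μ hf]
  exact (abs_sub _ _).trans (add_le_add le_rfl (hT'.trans (le_abs_self _)))

end SteinBound

section Conditioning

variable {Ω α β : Type*} {m0 : MeasurableSpace Ω} {P : Measure Ω}
  [MeasurableSpace α] [MeasurableSpace β]

lemma memLp_comp_iff_of_hasLaw {W : Ω → α} {ν : Measure α} (hW : HasLaw W ν P) {G : α → ℝ}
    (hG : AEStronglyMeasurable G ν) {p : ENNReal} :
    MemLp (fun ω => G (W ω)) p P ↔ MemLp G p ν := by
  rw [← hW.map_eq] at hG ⊢
  exact (memLp_map_measure_iff hG hW.aemeasurable).symm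

variable [IsProbabilityMeasure P]

lemma integral_comp_prodMk_eq_of_indepFun {W : Ω → α} {A : Ω → β} {ν : Measure α}
    (hW : HasLaw W ν P) (hA : AEMeasurable A P) (hWA : IndepFun W A P) {G : α × β → ℝ}
    (hG : Integrable G (ν.prod (P.map A))) :
    ∫ ω, G (W ω, A ω) ∂P = ∫ ω, ∫ x, G (x, A ω) ∂ν ∂P := by
  have : IsProbabilityMeasure ν := hW.isProbabilityMeasure_iff.1 inferInstance
  calc ∫ ω, G (W ω, A ω) ∂P = ∫ p, G p ∂ν.prod (P.map A) :=
        (hWA.hasLaw_prod hW ⟨hA, rfl⟩).integral_comp hG.1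
    _ = ∫ y, ∫ x, G (x, y) ∂ν ∂P.map A := integral_prod_symm G hG
    _ = ∫ ω, ∫ x, G (x, A ω) ∂ν ∂P := integral_map hA hG.integral_prod_right.1

lemma cdf_map_add_eq_of_indepFun {b Y : Ω → ℝ} {ν : Measure ℝ} (hb : HasLaw b ν P)
    (hY : AEMeasurable Y P) (hbY : IndepFun b Y P) (t : ℝ) :
    cdf (P.map fun ω => b ω + Y ω) t = ∫ ω, cdf ν (t - Y ω) ∂P := by
  have : IsProbabilityMeasure ν := hb.isProbabilityMeasure_iff.1 inferInstance
  have hadd : AEMeasurable (fun ω => b ω + Y ω) P := hb.aemeasurable.add hY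
  have := Measure.isProbabilityMeasure_map hadd
  let half : Set (ℝ × ℝ) := {p | p.1 + p.2 ≤ t}
  have hhalf : MeasurableSet half := measurableSet_le (by fun_prop) measurable_const
  have section_eq (y : ℝ) :
      ∫ u, half.indicator (1 : ℝ × ℝ → ℝ) (u, y) ∂ν = cdf ν (t - y) := by
    rw [cdf_eq_real, ← integral_indicator_one measurableSet_Iic]
    refine integral_congr_ae (ae_of_all _ fun u => ?_)
    simp only [half, Set.indicator, Set.mem_ofPred_eq, Set.mem_Iic, le_sub_iff_add_le, Pi.one_apply]
  calc cdf (P.map fun ω => b ω + Y ω) t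
      = ∫ s, (Set.Iic t).indicator 1 s ∂P.map fun ω => b ω + Y ω := by
        rw [cdf_eq_real, integral_indicator_one measurableSet_Iic]
    _ = ∫ ω, half.indicator (1 : ℝ × ℝ → ℝ) (b ω, Y ω) ∂P :=
        integral_map hadd (measurable_one.indicator measurableSet_Iic).aestronglyMeasurable
    _ = ∫ ω, ∫ u, half.indicator (1 : ℝ × ℝ → ℝ) (u, Y ω) ∂ν ∂P :=
        integral_comp_prodMk_eq_of_indepFun hb hY hbY ((integrable_const 1).indicator hhalf)
    _ = ∫ ω, cdf ν (t - Y ω) ∂P := by simp only [section_eq]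

lemma integral_abs_le_sqrt_integral_sq {Y : Ω → ℝ} (hY : MemLp Y 2 P) :
    ∫ ω, |Y ω| ∂P ≤ √(∫ ω, Y ω ^ 2 ∂P) := by
  refine Real.le_sqrt_of_sq_le ?_
  have h := variance_nonneg |Y| P
  rw [variance_eq_sub hY.abs] at h
  simp only [Pi.pow_apply, Pi.abs_apply, sq_abs] at h
  linarith

lemma abs_integral_mul_le_sqrt_integral_condExp_sq {m : MeasurableSpace Ω} (hm : m ≤ m0)
    {γ Z : Ω → ℝ} (hγ : StronglyMeasurable[m] γ) {B : ℝ} (hB : ∀ ω, |γ ω| ≤ B)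
    (hZ : MemLp Z 2 P) : |∫ ω, γ ω * Z ω ∂P| ≤ B * √(∫ ω, (P[Z | m]) ω ^ 2 ∂P) := by
  have hZ1 : Integrable Z P := hZ.integrable one_le_two
  have hi : Integrable (γ * Z) P :=
    hZ1.bdd_mul (hγ.mono hm).aestronglyMeasurable (ae_of_all _ hB)
  have hB0 : 0 ≤ B := by
    obtain ⟨ω⟩ := nonempty_of_isProbabilityMeasure P
    exact (abs_nonneg _).trans (hB ω)
  have hcond : MemLp (P[Z | m]) 2 P := hZ.condExp one_le_two
  calc |∫ ω, γ ω * Z ω ∂P| = |∫ ω, (P[γ * Z | m]) ω ∂P| := by rw [integral_condExp hm]; rfl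
    _ = |∫ ω, γ ω * (P[Z | m]) ω ∂P| := by
        rw [integral_congr_ae (condExp_mul_of_stronglyMeasurable_left hγ hi hZ1)]; rfl
    _ ≤ ∫ ω, B * |(P[Z | m]) ω| ∂P := by
        rw [← Real.norm_eq_abs]
        refine norm_integral_le_of_norm_le ((hcond.integrable one_le_two).abs.const_mul B)
          (ae_of_all _ fun ω => ?_)
        rw [Real.norm_eq_abs, abs_mul]
        exact mul_le_mul_of_nonneg_right (hB ω) (abs_nonneg _)
    _ = B * ∫ ω, |(P[Z | m]) ω| ∂P := integral_const_mul _ _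
    _ ≤ _ := mul_le_mul_of_nonneg_left (integral_abs_le_sqrt_integral_sq hcond) hB0

lemma abs_integral_fst_mul_le_sqrt_integral_condExp_sq {X : Ω → α} {X' : Ω → β}
    {ρ : Measure (α × β)} (hX : Measurable X) (hXX' : HasLaw (fun ω => (X ω, X' ω)) ρ P)
    {u : α → ℝ} (hu : Measurable u) {B : ℝ} (hB : ∀ x, |u x| ≤ B) {G : α × β → ℝ}
    (hG : MemLp G 2 ρ) :
    |∫ p, u p.1 * G p ∂ρ| ≤ B * √(∫ ω, (P[fun ω' => G (X ω', X' ω') |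
      MeasurableSpace.comap X inferInstance]) ω ^ 2 ∂P) := by
  have hpull : ∫ ω, u (X ω) * G (X ω, X' ω) ∂P = ∫ p, u p.1 * G p ∂ρ :=
    hXX'.integral_comp ((hu.comp measurable_fst).aestronglyMeasurable.mul hG.1)
  rw [← hpull]
  exact abs_integral_mul_le_sqrt_integral_condExp_sq hX.comap_le
    (hu.comp (comap_measurable X)).stronglyMeasurable (fun ω => hB _)
    ((memLp_comp_iff_of_hasLaw hXX' hG.1).2 hG)

end Conditioning

section IndependentFunctional

variable {Ω E : Type*} [MeasurableSpace Ω] {P : Measure Ω} [IsProbabilityMeasure P]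
  [MeasurableSpace E] {k : ℕ} {X X' : Ω → Fin k → E} {b : Ω → ℝ} {f : (Fin k → E) → ℝ}

lemma kolDist_le_of_forall_abs_cdf_sub_le {μ ν : Measure ℝ} [IsProbabilityMeasure μ]
    [IsProbabilityMeasure ν] {B : ℝ} (h : ∀ t, |cdf μ t - cdf ν t| ≤ B) : kolDist μ ν ≤ B :=
  ciSup_le fun t => by simpa only [cdf_eq_real] using h t

lemma exists_hasLaw_pairLaw (hX : Measurable X) (hind : iIndepFun (fun i ω => X ω i) P)
    (hid : IdentDistrib X' X P P) (hXX' : IndepFun X X' P) :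
    ∃ μ : Fin k → Measure E, (∀ i, IsProbabilityMeasure (μ i)) ∧
      HasLaw (fun ω => (X ω, X' ω)) (pairLaw μ) P := by
  have hXi (i : Fin k) : AEMeasurable (fun ω => X ω i) P :=
    ((measurable_pi_apply i).comp hX).aemeasurable
  have hlaw : HasLaw X (Measure.pi fun i => P.map fun ω => X ω i) P :=
    hind.hasLaw_pi fun i => ⟨hXi i, rfl⟩
  have hlaw' : HasLaw X' (Measure.pi fun i => P.map fun ω => X ω i) P :=
    ⟨hid.aemeasurable_fst, hid.map_eq.trans hlaw.map_eq⟩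
  exact ⟨_, fun i => Measure.isProbabilityMeasure_map (hXi i), hXX'.hasLaw_prod hlaw hlaw'⟩

theorem kolDist_add_le_of_hasLaw_pairLaw {μ : Fin k → Measure E} [∀ i, IsProbabilityMeasure (μ i)]
    (hX : Measurable X) (hXX' : HasLaw (fun ω => (X ω, X' ω)) (pairLaw μ) P) (hf : Measurable f)
    {c K : ℝ≥0} (hb : HasLaw b (gaussianReal 0 c) P) (hbX : IndepFun b X P) (hK : K ≠ 0)
    (hf4 : MemLp f 4 (Measure.pi μ)) (h0 : ∫ x, f x ∂Measure.pi μ = 0) :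
    kolDist (P.map fun ω => b ω + f (X ω)) (gaussianReal 0 K) ≤
      1 / (K : ℝ) * √(∫ ω, (P[fun ω' => (K : ℝ) - (c : ℝ) - steinT f (X ω') (X' ω') |
        MeasurableSpace.comap X inferInstance] ω) ^ 2 ∂P) +
      1 / (K : ℝ) * √(variance (P[fun ω' => steinT' f (X ω') (X' ω') |
        MeasurableSpace.comap X inferInstance]) P) := by
  have hf2 : MemLp f 2 (Measure.pi μ) := hf4.mono_exponent (by norm_num)
  have hlaw : HasLaw X (Measure.pi μ) P := measurePreserving_fst.hasLaw.comp hXX'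
  have hZ : MemLp (fun p : (Fin k → E) × (Fin k → E) => (K : ℝ) - c - steinT f p.1 p.2) 2
      (pairLaw μ) := (memLp_const _).sub (memLp_steinT μ hf4)
  have hT' := memLp_steinT' μ hf4
  have mean : ∫ ω, steinT' f (X ω) (X' ω) ∂P = 0 :=
    (hXX'.integral_comp hT'.1).trans (integral_steinT'_eq_zero μ hf2)
  have hcond := ((memLp_comp_iff_of_hasLaw hXX' hT'.1).2 hT').condExp
    (m := MeasurableSpace.comap X inferInstance) one_le_two
  rw [variance_of_integral_eq_zero hcond.1.aemeasurable
    (by rw [integral_condExp hX.comap_le, mean])]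
  have hsum : AEMeasurable (fun ω => b ω + f (X ω)) P :=
    hb.aemeasurable.add (hf.comp hX).aemeasurable
  have := Measure.isProbabilityMeasure_map hsum
  refine kolDist_le_of_forall_abs_cdf_sub_le fun t => ?_
  obtain ⟨γ, ψ, hγ, hψ, hγK, hψK, hbound⟩ := exists_abs_integral_cdf_sub_le μ hf2 h0 c hK t
  have hcdf : ∫ ω, cdf (gaussianReal 0 c) (t - f (X ω)) ∂P =
      ∫ x, cdf (gaussianReal 0 c) (t - f x) ∂Measure.pi μ :=
    hlaw.integral_comp (integrable_cdf_comp (hf.aemeasurable.const_sub t)).1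
  rw [cdf_map_add_eq_of_indepFun (Y := fun ω => f (X ω)) hb (hf.comp hX).aemeasurable
    (hbX.comp measurable_id hf) t, hcdf]
  exact hbound.trans (add_le_add
    (abs_integral_fst_mul_le_sqrt_integral_condExp_sq hX hXX' (hγ.comp hf) (fun _ => hγK _) hZ)
    (abs_integral_fst_mul_le_sqrt_integral_condExp_sq hX hXX' (hψ.comp hf) (fun _ => hψK _) hT'))

end IndependentFunctional

section Moments

variable {Ω : Type*} {m0 : MeasurableSpace Ω} {P : Measure Ω} {Y : Ω → ℝ}

lemma memLp_of_integrable_abs_pow (hY : AEStronglyMeasurable Y P) {n : ℕ} (hn : n ≠ 0)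
    (h : Integrable (fun ω => |Y ω| ^ n) P) : MemLp Y n P :=
  (integrable_norm_rpow_iff hY (Nat.cast_ne_zero.2 hn) (ENNReal.natCast_ne_top n)).1
    (by simpa only [ENNReal.toReal_natCast, Real.rpow_natCast, Real.norm_eq_abs] using h)

lemma abs_integral_mul_le_of_abs_le {u Z S : Ω → ℝ} {B : ℝ} (hu : ∀ ω, |u ω| ≤ B)
    (hZ : ∀ ω, |Z ω| ≤ S ω) (hS : Integrable S P) :
    |∫ ω, u ω * Z ω ∂P| ≤ B * ∫ ω, S ω ∂P := by
  rw [← Real.norm_eq_abs, ← integral_const_mul]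
  refine norm_integral_le_of_norm_le (hS.const_mul B) (ae_of_all _ fun ω => ?_)
  rw [Real.norm_eq_abs, abs_mul]
  exact mul_le_mul (hu ω) (hZ ω) (abs_nonneg _) ((abs_nonneg _).trans (hu ω))

lemma memLp_two_sqrt (hY : Integrable Y P) (h0 : ∀ ω, 0 ≤ Y ω) : MemLp (fun ω => √(Y ω)) 2 P := by
  refine (memLp_two_iff_integrable_sq ?_).2 (by simpa only [Real.sq_sqrt (h0 _)] using hY)
  exact Real.continuous_sqrt.comp_aestronglyMeasurable hY.1

variable [IsProbabilityMeasure P]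

lemma integrable_pow_of_memLp {p : ENNReal} (hY : MemLp Y p P) {i : ℕ} (hi : (i : ENNReal) ≤ p) :
    Integrable (fun ω => Y ω ^ i) P := by
  refine (integrable_norm_iff (hY.1.pow i)).1 ?_
  simpa only [Pi.pow_apply, norm_pow] using (hY.mono_exponent hi).integrable_norm_pow'

lemma one_le_integral_pow_four (hY : MemLp Y 4 P) (h2 : ∫ ω, Y ω ^ 2 ∂P = 1) :
    1 ≤ ∫ ω, Y ω ^ 4 ∂P := by
  have i2 : Integrable (fun ω => 2 * Y ω ^ 2) P :=
    (integrable_pow_of_memLp hY (by norm_num)).const_mul 2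
  have h : ∫ ω, (2 * Y ω ^ 2 - 1) ∂P ≤ ∫ ω, Y ω ^ 4 ∂P :=
    integral_mono (i2.sub (integrable_const 1)) (integrable_pow_of_memLp hY (by norm_num))
      fun ω => by simp only; nlinarith [sq_nonneg (Y ω ^ 2 - 1)]
  rw [integral_sub i2 (integrable_const 1), integral_const_mul, h2] at h
  simp only [integral_const, probReal_univ, smul_eq_mul] at h
  linarith

lemma integral_pow_four_le_integral_pow_six (hY : MemLp Y 6 P) (h2 : ∫ ω, Y ω ^ 2 ∂P = 1) :
    ∫ ω, Y ω ^ 4 ∂P ≤ ∫ ω, Y ω ^ 6 ∂P := by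
  have i2 : Integrable (fun ω => Y ω ^ 2 - 1) P :=
    (integrable_pow_of_memLp hY (by norm_num)).sub (integrable_const 1)
  have i4 : Integrable (fun ω => Y ω ^ 4) P := integrable_pow_of_memLp hY (by norm_num)
  have h : ∫ ω, (Y ω ^ 4 + (Y ω ^ 2 - 1)) ∂P ≤ ∫ ω, Y ω ^ 6 ∂P :=
    integral_mono (i4.add i2) (integrable_pow_of_memLp hY (by norm_num)) fun ω => by
      simp only
      nlinarith [mul_nonneg (by positivity : 0 ≤ Y ω ^ 2 + 1) (sq_nonneg (Y ω ^ 2 - 1))]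
  rw [integral_add i4 i2, integral_sub (integrable_pow_of_memLp hY (by norm_num))
    (integrable_const 1), h2] at h
  simpa using h

lemma sqrt_integral_pow_four_le (hY : MemLp Y 6 P) :
    √(∫ ω, Y ω ^ 4 ∂P) ≤ 1 + √(∫ ω, |Y ω| ^ 6 ∂P) := by
  have i6 : Integrable (fun ω => |Y ω| ^ 6) P := integrable_pow_of_memLp hY.abs (by norm_num)
  have h : ∫ ω, Y ω ^ 4 ∂P ≤ ∫ ω, (1 + |Y ω| ^ 6) ∂P :=
    integral_mono (integrable_pow_of_memLp hY (by norm_num)) ((integrable_const 1).add i6)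
      fun ω => by
        simp only [Even.pow_abs (by decide : Even 6)]
        nlinarith [mul_nonneg (sq_nonneg (Y ω)) (sq_nonneg (Y ω ^ 2 - 1)),
          sq_nonneg (Y ω ^ 2 - 1)]
  rw [integral_add (integrable_const 1) i6] at h
  simp only [integral_const, probReal_univ, one_smul] at h
  have h0 : 0 ≤ ∫ ω, |Y ω| ^ 6 ∂P := integral_nonneg fun ω => by positivity
  rw [Real.sqrt_le_left (by positivity)]
  nlinarith [Real.sq_sqrt h0, Real.sqrt_nonneg (∫ ω, |Y ω| ^ 6 ∂P)]

lemma sqrt_integral_pow_four_mul_le {W : Ω → ℝ} (hW : MemLp W 6 P) (hW2 : ∫ ω, W ω ^ 2 ∂P = 1)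
    (hY : MemLp Y 6 P) {c r R : ℝ} (hc : 0 ≤ c) (hr : 0 ≤ r) (hR : 0 ≤ R) :
    c * √(∫ ω, W ω ^ 4 ∂P) * √(∫ ω, Y ω ^ 4 ∂P) * r ≤
      c * √(∫ ω, W ω ^ 6 ∂P) * (1 + √(∫ ω, |Y ω| ^ 6 ∂P)) * (R + r) := by
  have hW46 := Real.sqrt_le_sqrt (integral_pow_four_le_integral_pow_six hW hW2)
  have hY46 := sqrt_integral_pow_four_le hY
  have hrR := le_add_of_nonneg_left hR (a := r)
  gcongr ?_ * ?_ * ?_ * ?_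

lemma integral_sqrt_le_sqrt_integral (hY : Integrable Y P) (h0 : ∀ ω, 0 ≤ Y ω) :
    ∫ ω, √(Y ω) ∂P ≤ √(∫ ω, Y ω ∂P) := by
  simpa only [abs_of_nonneg (Real.sqrt_nonneg _), Real.sq_sqrt (h0 _)] using
    integral_abs_le_sqrt_integral_sq (memLp_two_sqrt hY h0)

end Moments

section LinearForm

variable {n : ℕ}

lemma resampleDiff_linear (a : Fin n → ℝ) {j : Fin n} {A : Finset (Fin n)} (hj : j ∉ A)
    (x x' : Fin n → ℝ) :
    resampleDiff (fun y => ∑ i, a i * y i) j A x x' = a j * (x j - x' j) := by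
  rw [resampleDiff, ← Finset.sum_sub_distrib, Finset.sum_eq_single j]
  · simp only [resample, hj, Finset.mem_insert_self, if_true, if_false]; ring
  · intro i _ hi
    simp [resample, hi]
  · simp

lemma steinT_linear (a x x' : Fin n → ℝ) :
    steinT (fun y => ∑ i, a i * y i) x x' = ∑ j, a j ^ 2 * (1 / 2 * (x j - x' j) ^ 2) := by
  rw [steinT_eq_resampleSum, resampleSum_congr (a' := fun _ j => a j ^ 2 * (x j - x' j) ^ 2),
    resampleSum_const, Finset.mul_sum]
  · exact Finset.sum_congr rfl fun j _ => by ring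
  · intro A j hj
    rw [resampleDiff_linear a hj, resampleDiff_linear a (Finset.notMem_empty j)]
    ring

lemma steinT'_linear (a x x' : Fin n → ℝ) :
    steinT' (fun y => ∑ i, a i * y i) x x' =
      ∑ j, (a j * |a j|) * (1 / 2 * ((x j - x' j) * |x j - x' j|)) := by
  rw [steinT'_eq_resampleSum, resampleSum_congr
    (a' := fun _ j => (a j * |a j|) * ((x j - x' j) * |x j - x' j|)),
    resampleSum_const, Finset.mul_sum]
  · exact Finset.sum_congr rfl fun j _ => by ring
  · intro A j hj
    rw [resampleDiff_linear a hj, resampleDiff_linear a (Finset.notMem_empty j), abs_mul]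
    ring

section IID

variable {α : Type*} [MeasurableSpace α] {ν : Measure α} [IsProbabilityMeasure ν] {q : α → ℝ}

lemma memLp_sum_mul_eval {p : ENNReal} (hq : MemLp q p ν) (c : Fin n → ℝ) :
    MemLp (fun y : Fin n → α => ∑ j, c j * q (y j)) p (Measure.pi fun _ => ν) :=
  memLp_finsetSum _ fun j _ =>
    (hq.comp_measurePreserving (measurePreserving_eval (fun _ => ν) j)).const_mul (c j)

lemma integral_sum_mul_eval_eq_zero (hq : Integrable q ν) (h0 : ∫ x, q x ∂ν = 0)
    (c : Fin n → ℝ) : ∫ y : Fin n → α, ∑ j, c j * q (y j) ∂Measure.pi (fun _ => ν) = 0 := by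
  have hi (j : Fin n) : Integrable (fun y : Fin n → α => c j * q (y j))
      (Measure.pi fun _ => ν) :=
    ((measurePreserving_eval (fun _ => ν) j).integrable_comp_of_integrable hq).const_mul (c j)
  rw [integral_finsetSum _ fun j _ => hi j]
  refine Finset.sum_eq_zero fun j _ => ?_
  rw [integral_const_mul, integral_comp_eval (μ := fun _ : Fin n => ν) hq.1, h0, mul_zero]

lemma integral_sq_sum_mul_eval (hq : MemLp q 2 ν) (h0 : ∫ x, q x ∂ν = 0) (c : Fin n → ℝ) :
    ∫ y : Fin n → α, (∑ j, c j * q (y j)) ^ 2 ∂Measure.pi (fun _ => ν) =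
      (∫ x, q x ^ 2 ∂ν) * ∑ j, c j ^ 2 := by
  have hsum : (∑ j, fun y : Fin n → α => c j * q (y j)) = fun y => ∑ j, c j * q (y j) := by
    funext y
    exact Finset.sum_apply _ _ _
  have hvar := variance_sum_pi (μ := fun _ : Fin n => ν) (X := fun j x => c j * q x)
    fun j => hq.const_mul (c j)
  simp only [hsum, variance_const_mul, variance_of_integral_eq_zero hq.aemeasurable h0] at hvar
  rw [variance_of_integral_eq_zero (memLp_sum_mul_eval hq c).aemeasurable
    (integral_sum_mul_eval_eq_zero (hq.integrable one_le_two) h0 c)] at hvar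
  rw [hvar, ← Finset.sum_mul, mul_comm]

end IID

variable {w : Measure ℝ} [IsProbabilityMeasure w]

lemma measurePreserving_pairs :
    MeasurePreserving (fun (p : (Fin n → ℝ) × (Fin n → ℝ)) j => (p.1 j, p.2 j))
      (pairLaw fun _ => w) (Measure.pi fun _ => w.prod w) :=
  (measurePreserving_arrowProdEquivProdArrow ℝ ℝ (Fin n) (fun _ => w) fun _ => w).symm

lemma memLp_sum_mul_pairs {q : ℝ × ℝ → ℝ} (hq : MemLp q 2 (w.prod w)) (c : Fin n → ℝ) :
    MemLp (fun p : (Fin n → ℝ) × (Fin n → ℝ) => ∑ j, c j * q (p.1 j, p.2 j)) 2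
      (pairLaw fun _ => w) :=
  (memLp_sum_mul_eval hq c).comp_measurePreserving measurePreserving_pairs

lemma integral_abs_sum_mul_pairs_le {q : ℝ × ℝ → ℝ} (hq : MemLp q 2 (w.prod w))
    (h0 : ∫ p, q p ∂w.prod w = 0) (c : Fin n → ℝ) :
    ∫ p, |∑ j, c j * q (p.1 j, p.2 j)| ∂pairLaw (fun _ => w) ≤
      √(∫ p, q p ^ 2 ∂w.prod w) * √(∑ j, c j ^ 2) := by
  have hsum := memLp_sum_mul_eval hq c
  calc ∫ p, |∑ j, c j * q (p.1 j, p.2 j)| ∂pairLaw (fun _ => w)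
      = ∫ y, |∑ j, c j * q (y j)| ∂Measure.pi fun _ => w.prod w :=
        measurePreserving_pairs.hasLaw.integral_comp hsum.abs.1
    _ ≤ √(∫ y, (∑ j, c j * q (y j)) ^ 2 ∂Measure.pi fun _ => w.prod w) :=
        integral_abs_le_sqrt_integral_sq hsum
    _ = _ := by
        rw [integral_sq_sum_mul_eval hq h0, Real.sqrt_mul (integral_nonneg fun p => sq_nonneg _)]

lemma memLp_fst_sub_snd (h4 : MemLp id 4 w) :
    MemLp (fun p : ℝ × ℝ => p.1 - p.2) 4 (w.prod w) :=
  (h4.comp_fst w).sub (h4.comp_snd w)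

lemma integral_fst_sub_snd_sq (h4 : MemLp id 4 w) (h1 : ∫ x, x ∂w = 0) (h2 : ∫ x, x ^ 2 ∂w = 1) :
    ∫ p : ℝ × ℝ, (p.1 - p.2) ^ 2 ∂w.prod w = 2 := by
  have i1 : Integrable (fun x : ℝ => x) w := h4.integrable (by norm_num)
  have i2 : Integrable (fun x : ℝ => x ^ 2) w := integrable_pow_of_memLp h4 (by norm_num)
  have hsq : Integrable (fun p : ℝ × ℝ => p.1 ^ 2 + p.2 ^ 2) (w.prod w) :=
    (i2.comp_fst w).add (i2.comp_snd w)
  calc ∫ p : ℝ × ℝ, (p.1 - p.2) ^ 2 ∂w.prod w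
      = ∫ p : ℝ × ℝ, (p.1 ^ 2 + p.2 ^ 2 - 2 * (p.1 * p.2)) ∂w.prod w := by
        congr with p; ring
    _ = 2 * ∫ x, x ^ 2 ∂w - 2 * ((∫ x, x ∂w) * ∫ x, x ∂w) := by
        rw [integral_sub hsq ((i1.mul_prod i1).const_mul 2),
          integral_add (i2.comp_fst w) (i2.comp_snd w), integral_const_mul,
          integral_prod_mul (fun x : ℝ => x) fun x : ℝ => x, integral_fun_fst fun x : ℝ => x ^ 2,
          integral_fun_snd fun x : ℝ => x ^ 2]
        simp only [probReal_univ, one_smul]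
        ring
    _ = 2 := by rw [h1, h2]; norm_num

lemma integral_fst_sub_snd_pow_four (h4 : MemLp id 4 w) (h1 : ∫ x, x ∂w = 0)
    (h2 : ∫ x, x ^ 2 ∂w = 1) :
    ∫ p : ℝ × ℝ, (p.1 - p.2) ^ 4 ∂w.prod w = 2 * ∫ x, x ^ 4 ∂w + 6 := by
  have mixed {i j : ℕ} (hi : i ≤ 4) (hj : j ≤ 4) (r : ℝ) :
      Integrable (fun p : ℝ × ℝ => r * (p.1 ^ i * p.2 ^ j)) (w.prod w) :=
    ((integrable_pow_of_memLp h4 (by exact_mod_cast hi)).mul_prod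
      (integrable_pow_of_memLp h4 (by exact_mod_cast hj))).const_mul r
  have integral_mixed (i j : ℕ) (r : ℝ) : ∫ p : ℝ × ℝ, r * (p.1 ^ i * p.2 ^ j) ∂w.prod w =
      r * ((∫ x, x ^ i ∂w) * ∫ x, x ^ j ∂w) := by
    rw [integral_const_mul, integral_prod_mul (fun x : ℝ => x ^ i) fun x : ℝ => x ^ j]
  calc ∫ p : ℝ × ℝ, (p.1 - p.2) ^ 4 ∂w.prod w
      = ∫ p : ℝ × ℝ, ∑ i ∈ Finset.range 5, (-1) ^ (4 - i) * (Nat.choose 4 i : ℝ) *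
          (p.1 ^ i * p.2 ^ (4 - i)) ∂w.prod w := by
        congr with p
        rw [sub_eq_add_neg, add_pow]
        refine Finset.sum_congr rfl fun i _ => ?_
        rw [neg_pow]
        ring
    _ = ∑ i ∈ Finset.range 5, (-1) ^ (4 - i) * (Nat.choose 4 i : ℝ) *
          ((∫ x, x ^ i ∂w) * ∫ x, x ^ (4 - i) ∂w) := by
        rw [integral_finsetSum _ fun i hi =>
          mixed (Nat.lt_succ_iff.1 (Finset.mem_range.1 hi)) (Nat.sub_le 4 i) _]
        exact Finset.sum_congr rfl fun i _ => integral_mixed i (4 - i) _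
    _ = 2 * ∫ x, x ^ 4 ∂w + 6 := by
        simp [Finset.sum_range_succ, Nat.choose, h1, h2]
        ring

lemma integral_half_sq_fst_sub_snd_sub_one (h4 : MemLp id 4 w) (h1 : ∫ x, x ∂w = 0)
    (h2 : ∫ x, x ^ 2 ∂w = 1) :
    ∫ p : ℝ × ℝ, (1 / 2 * (p.1 - p.2) ^ 2 - 1) ∂w.prod w = 0 := by
  have hsq : Integrable (fun p : ℝ × ℝ => (p.1 - p.2) ^ 2) (w.prod w) :=
    ((memLp_fst_sub_snd h4).mono_exponent (by norm_num)).integrable_sq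
  rw [integral_sub (hsq.const_mul _) (integrable_const 1), integral_const_mul,
    integral_fst_sub_snd_sq h4 h1 h2]
  simp

lemma integral_sq_half_sq_fst_sub_snd_sub_one (h4 : MemLp id 4 w) (h1 : ∫ x, x ∂w = 0)
    (h2 : ∫ x, x ^ 2 ∂w = 1) :
    ∫ p : ℝ × ℝ, (1 / 2 * (p.1 - p.2) ^ 2 - 1) ^ 2 ∂w.prod w =
      1 / 2 * ∫ x, x ^ 4 ∂w + 1 / 2 := by
  have hD := memLp_fst_sub_snd h4
  have hsq : Integrable (fun p : ℝ × ℝ => (p.1 - p.2) ^ 2) (w.prod w) :=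
    (hD.mono_exponent (by norm_num)).integrable_sq
  have hfour : Integrable (fun p : ℝ × ℝ => 1 / 4 * (p.1 - p.2) ^ 4) (w.prod w) := by
    refine Integrable.const_mul ?_ _
    convert (memLp_two_mul hD hD).integrable_sq using 2 with p
    ring
  have hdiff : Integrable (fun p : ℝ × ℝ => 1 / 4 * (p.1 - p.2) ^ 4 - (p.1 - p.2) ^ 2)
      (w.prod w) := hfour.sub hsq
  calc ∫ p : ℝ × ℝ, (1 / 2 * (p.1 - p.2) ^ 2 - 1) ^ 2 ∂w.prod w
      = ∫ p : ℝ × ℝ, (1 / 4 * (p.1 - p.2) ^ 4 - (p.1 - p.2) ^ 2 + 1) ∂w.prod w := by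
        congr with p; ring
    _ = 1 / 4 * (2 * ∫ x, x ^ 4 ∂w + 6) - 2 + 1 := by
        rw [integral_add hdiff (integrable_const 1), integral_sub hfour hsq,
          integral_const_mul, integral_fst_sub_snd_sq h4 h1 h2,
          integral_fst_sub_snd_pow_four h4 h1 h2]
        simp
    _ = 1 / 2 * ∫ x, x ^ 4 ∂w + 1 / 2 := by ring

lemma integral_half_mul_abs_fst_sub_snd :
    ∫ p : ℝ × ℝ, 1 / 2 * ((p.1 - p.2) * |p.1 - p.2|) ∂w.prod w = 0 := by
  refine integral_eq_zero_of_comp_eq_neg Measure.measurePreserving_swap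
    (by fun_prop) fun p => ?_
  simp only [Prod.fst_swap, Prod.snd_swap, abs_sub_comm p.2 p.1]
  ring

lemma integral_sq_half_mul_abs_fst_sub_snd (h4 : MemLp id 4 w) (h1 : ∫ x, x ∂w = 0)
    (h2 : ∫ x, x ^ 2 ∂w = 1) :
    ∫ p : ℝ × ℝ, (1 / 2 * ((p.1 - p.2) * |p.1 - p.2|)) ^ 2 ∂w.prod w =
      1 / 2 * ∫ x, x ^ 4 ∂w + 3 / 2 := by
  calc ∫ p : ℝ × ℝ, (1 / 2 * ((p.1 - p.2) * |p.1 - p.2|)) ^ 2 ∂w.prod w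
      = ∫ p : ℝ × ℝ, 1 / 4 * (p.1 - p.2) ^ 4 ∂w.prod w := by
        congr with p
        rw [mul_pow, mul_pow, sq_abs]
        ring
    _ = 1 / 2 * ∫ x, x ^ 4 ∂w + 3 / 2 := by
        rw [integral_const_mul, integral_fst_sub_snd_pow_four h4 h1 h2]
        ring

lemma abs_integral_mul_sub_steinT_linear_le (h4 : MemLp id 4 w) (h1 : ∫ x, x ∂w = 0)
    (h2 : ∫ x, x ^ 2 ∂w = 1) (a : Fin n → ℝ) (d : ℝ) {u : (Fin n → ℝ) × (Fin n → ℝ) → ℝ} {B : ℝ}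
    (hu : ∀ p, |u p| ≤ B) :
    |∫ p, u p * (d - steinT (fun y => ∑ i, a i * y i) p.1 p.2) ∂pairLaw (fun _ => w)| ≤
      B * (|d - ∑ j, a j ^ 2| + √(∫ x, x ^ 4 ∂w) * √(∑ j, a j ^ 4)) := by
  set q : ℝ × ℝ → ℝ := fun p => 1 / 2 * (p.1 - p.2) ^ 2 - 1 with hq
  have hD := memLp_fst_sub_snd h4
  have hqL : MemLp q 2 (w.prod w) := by
    refine MemLp.sub (MemLp.const_mul ?_ _) (memLp_const 1)
    simpa only [sq] using memLp_two_mul hD hD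
  have second_moment : ∫ p, q p ^ 2 ∂w.prod w ≤ ∫ x, x ^ 4 ∂w := by
    rw [hq, integral_sq_half_sq_fst_sub_snd_sub_one h4 h1 h2]
    have hm4 : 1 ≤ ∫ x, x ^ 4 ∂w := one_le_integral_pow_four h4 h2
    linarith
  have hS : Integrable (fun p : (Fin n → ℝ) × (Fin n → ℝ) =>
      |∑ j, a j ^ 2 * q (p.1 j, p.2 j)|) (pairLaw fun _ => w) :=
    ((memLp_sum_mul_pairs hqL _).integrable one_le_two).abs
  have split (p : (Fin n → ℝ) × (Fin n → ℝ)) :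
      |d - steinT (fun y => ∑ i, a i * y i) p.1 p.2| ≤
        |d - ∑ j, a j ^ 2| + |∑ j, a j ^ 2 * q (p.1 j, p.2 j)| := by
    refine (abs_sub _ _).trans' (le_of_eq (congrArg _ ?_))
    rw [steinT_linear]
    simp only [hq, mul_sub, mul_one, Finset.sum_sub_distrib]
    ring
  have hB : 0 ≤ B := (abs_nonneg _).trans (hu 0)
  refine (abs_integral_mul_le_of_abs_le hu split ((integrable_const _).add hS)).trans
    (mul_le_mul_of_nonneg_left ?_ hB)
  rw [integral_add (integrable_const _) hS, integral_const, probReal_univ, one_smul]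
  refine add_le_add_right ((integral_abs_sum_mul_pairs_le hqL
    (integral_half_sq_fst_sub_snd_sub_one h4 h1 h2) _).trans ?_) _
  simp only [← pow_mul]
  gcongr

lemma abs_integral_mul_steinT'_linear_le (h4 : MemLp id 4 w) (h1 : ∫ x, x ∂w = 0)
    (h2 : ∫ x, x ^ 2 ∂w = 1) (a : Fin n → ℝ) {u : (Fin n → ℝ) × (Fin n → ℝ) → ℝ} {B : ℝ}
    (hu : ∀ p, |u p| ≤ B) :
    |∫ p, u p * steinT' (fun y => ∑ i, a i * y i) p.1 p.2 ∂pairLaw (fun _ => w)| ≤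
      B * (3 / 2 * √(∫ x, x ^ 4 ∂w) * √(∑ j, a j ^ 4)) := by
  set q : ℝ × ℝ → ℝ := fun p => 1 / 2 * ((p.1 - p.2) * |p.1 - p.2|) with hq
  have hD := memLp_fst_sub_snd h4
  have hqL : MemLp q 2 (w.prod w) := (memLp_two_mul hD hD.abs).const_mul _
  have root_second_moment : √(∫ p, q p ^ 2 ∂w.prod w) ≤ 3 / 2 * √(∫ x, x ^ 4 ∂w) := by
    have hm4 : 1 ≤ ∫ x, x ^ 4 ∂w := one_le_integral_pow_four h4 h2
    rw [hq, integral_sq_half_mul_abs_fst_sub_snd h4 h1 h2, Real.sqrt_le_left (by positivity),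
      mul_pow, Real.sq_sqrt (by linarith)]
    linarith
  have hB : 0 ≤ B := (abs_nonneg _).trans (hu 0)
  have hfourth (j : Fin n) : (a j * |a j|) ^ 2 = a j ^ 4 := by rw [mul_pow, sq_abs]; ring
  simp only [steinT'_linear]
  refine (abs_integral_mul_le_of_abs_le hu (fun p => le_rfl)
    ((memLp_sum_mul_pairs hqL _).integrable one_le_two).abs).trans
    (mul_le_mul_of_nonneg_left ?_ hB)
  refine (integral_abs_sum_mul_pairs_le hqL integral_half_mul_abs_fst_sub_snd _).trans ?_
  simp only [hfourth]
  gcongr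

theorem abs_integral_cdf_linear_sub_le (h4 : MemLp id 4 w) (h1 : ∫ x, x ∂w = 0)
    (h2 : ∫ x, x ^ 2 ∂w = 1) (a : Fin n → ℝ) (c : ℝ≥0) {K : ℝ≥0} (hK : K ≠ 0) (t : ℝ) :
    |∫ x, cdf (gaussianReal 0 c) (t - ∑ j, a j * x j) ∂(Measure.pi fun _ => w) -
      cdf (gaussianReal 0 K) t| ≤
    1 / (K : ℝ) * (|(K : ℝ) - c - ∑ j, a j ^ 2| +
      5 / 2 * √(∫ x, x ^ 4 ∂w) * √(∑ j, a j ^ 4)) := by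
  obtain ⟨γ, ψ, -, -, hγ, hψ, hbound⟩ := exists_abs_integral_cdf_sub_le (fun _ : Fin n => w)
    (memLp_sum_mul_eval (h4.mono_exponent (by norm_num)) a)
    (integral_sum_mul_eval_eq_zero (h4.integrable (by norm_num)) h1 a) c hK t
  refine hbound.trans ((add_le_add
    (abs_integral_mul_sub_steinT_linear_le h4 h1 h2 a _ fun p => hγ _)
    (abs_integral_mul_steinT'_linear_le h4 h1 h2 a fun p => hψ _)).trans_eq ?_)
  ring

end LinearForm

namespace RandomNN

variable {Ω : Type*} [MeasurableSpace Ω] {P : Measure Ω} {L : ℕ} (N : RandomNN P L)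
  (x : Fin (N.width 0) → ℝ)

/-- The values which layer `ℓ` passes on to layer `ℓ + 1`: the input for `ℓ = 0`, and the activated
neurons for `ℓ ≥ 1`. -/
def act : (ℓ : ℕ) → Fin (N.width ℓ) → Ω → ℝ
  | 0 => fun k _ => x k
  | ℓ + 1 => fun k ω => N.σ (N.z x (ℓ + 1) k ω)

/-- The coefficient of the `k`-th weight in each neuron `N.z x (ℓ + 1) j`, as a linear form in the
weights of layer `ℓ`. -/
def coeff (ℓ : ℕ) (k : Fin (N.width ℓ)) (ω : Ω) : ℝ :=
  √(N.CW : ℝ) / √(N.width ℓ : ℝ) * N.act x ℓ k ω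

lemma z_succ (ℓ : ℕ) (j : Fin (N.width (ℓ + 1))) :
    N.z x (ℓ + 1) j = fun ω => N.bias ℓ j ω + ∑ k, N.coeff x ℓ k ω * N.weight ℓ j k ω := by
  funext ω
  cases ℓ <;>
  · simp only [z, coeff, act, Finset.mul_sum]
    congr 1
    exact Finset.sum_congr rfl fun k _ => by ring

lemma integral_weight_sq {ℓ : ℕ} (hℓ : ℓ ≤ L) (j : Fin (N.width (ℓ + 1))) (k : Fin (N.width ℓ)) :
    ∫ ω, N.weight ℓ j k ω ^ 2 ∂P = 1 :=
  ((N.hasLaw_weight ℓ hℓ j k).integral_comp (f := fun u => u ^ 2) (by fun_prop)).trans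
    N.sq_weightLaw

section Parameters

/-- The index type of the family of all weights (left) and biases (right) of the network. -/
abbrev ParamIndex : Type :=
  (Σ ℓ : Fin (L + 1), Fin (N.width (ℓ + 1)) × Fin (N.width ℓ)) ⊕
    (Σ ℓ : Fin (L + 1), Fin (N.width (ℓ + 1)))

/-- The family of all weights and biases of the network. -/
def param : N.ParamIndex → Ω → ℝ :=
  Sum.elim (fun p => N.weight p.1 p.2.1 p.2.2) (fun p => N.bias p.1 p.2)

/-- The layer `ℓ` out of which a parameter leads, that is the first argument of `N.weight` or
`N.bias`. -/
def layer : N.ParamIndex → ℕ := Sum.elim (fun p => p.1) (fun p => p.1)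

/-- The σ-algebra generated by the parameters in `S`. -/
abbrev paramAlgebra (S : Set N.ParamIndex) : MeasurableSpace Ω :=
  ⨆ i ∈ S, MeasurableSpace.comap (N.param i) inferInstance

lemma measurable_param (i : N.ParamIndex) : Measurable (N.param i) := by
  rcases i with ⟨ℓ, j, k⟩ | ⟨ℓ, j⟩
  · exact N.measurable_weight ℓ (Nat.lt_succ_iff.1 ℓ.2) j k
  · exact N.measurable_bias ℓ (Nat.lt_succ_iff.1 ℓ.2) j

lemma measurable_param_paramAlgebra {S : Set N.ParamIndex} {i : N.ParamIndex} (hi : i ∈ S) :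
    Measurable[N.paramAlgebra S] (N.param i) :=
  Measurable.mono (comap_measurable _)
    (le_iSup₂ (f := fun i _ => MeasurableSpace.comap (N.param i) inferInstance) i hi) le_rfl

lemma measurable_weight_paramAlgebra {S : Set N.ParamIndex} {ℓ : ℕ} (hℓ : ℓ < L + 1)
    {j : Fin (N.width (ℓ + 1))} {k : Fin (N.width ℓ)} (h : Sum.inl ⟨⟨ℓ, hℓ⟩, j, k⟩ ∈ S) :
    Measurable[N.paramAlgebra S] (N.weight ℓ j k) :=
  N.measurable_param_paramAlgebra h

lemma measurable_bias_paramAlgebra {S : Set N.ParamIndex} {ℓ : ℕ} (hℓ : ℓ < L + 1)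
    {j : Fin (N.width (ℓ + 1))} (h : Sum.inr ⟨⟨ℓ, hℓ⟩, j⟩ ∈ S) :
    Measurable[N.paramAlgebra S] (N.bias ℓ j) :=
  N.measurable_param_paramAlgebra h

lemma paramAlgebra_mono {S T : Set N.ParamIndex} (h : S ⊆ T) :
    N.paramAlgebra S ≤ N.paramAlgebra T := biSup_mono h

lemma paramAlgebra_le (S : Set N.ParamIndex) :
    N.paramAlgebra S ≤ (inferInstance : MeasurableSpace Ω) :=
  iSup₂_le fun i _ => (N.measurable_param i).comap_le

lemma indepFun_of_measurable_paramAlgebra {α β : Type*} [MeasurableSpace α] [MeasurableSpace β]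
    {S T : Set N.ParamIndex} (h : Disjoint S T) {Y : Ω → α} {Z : Ω → β}
    (hY : Measurable[N.paramAlgebra S] Y) (hZ : Measurable[N.paramAlgebra T] Z) :
    IndepFun Y Z P :=
  (IndepFun_iff_Indep _ _ _).2 (indep_of_indep_of_le_left (indep_of_indep_of_le_right
    (indep_iSup_of_disjoint (fun i => (N.measurable_param i).comap_le) N.indep h)
    hZ.comap_le) hY.comap_le)

lemma measurable_act_paramAlgebra {ℓ : ℕ} (hℓ : ℓ ≤ L) (k : Fin (N.width ℓ)) :
    Measurable[N.paramAlgebra {i | N.layer i < ℓ}] (N.act x ℓ k) := by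
  induction ℓ with
  | zero => exact measurable_const
  | succ ℓ ih =>
    have hlt : ℓ < L + 1 := Nat.lt_succ_of_lt hℓ
    have hact : N.act x (ℓ + 1) k = fun ω => N.σ (N.bias ℓ k ω +
        ∑ i, N.coeff x ℓ i ω * N.weight ℓ k i ω) := by
      funext ω
      simp only [act, z_succ]
    have hbias : Measurable[N.paramAlgebra {i | N.layer i < ℓ + 1}] (N.bias ℓ k) :=
      N.measurable_bias_paramAlgebra hlt (Nat.lt_succ_self ℓ)
    have hweight (i) : Measurable[N.paramAlgebra {i | N.layer i < ℓ + 1}] (N.weight ℓ k i) :=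
      N.measurable_weight_paramAlgebra hlt (Nat.lt_succ_self ℓ)
    have hcoeff (i) : Measurable[N.paramAlgebra {i | N.layer i < ℓ + 1}] (N.coeff x ℓ i) :=
      ((ih (Nat.le_of_succ_le hℓ) i).mono
        (N.paramAlgebra_mono fun _ => Nat.lt_succ_of_lt) le_rfl).const_mul _
    rw [hact]
    exact N.measurable_σ.comp
      (hbias.add (Finset.measurable_sum _ fun i _ => (hcoeff i).mul (hweight i)))

lemma measurable_coeff_paramAlgebra {ℓ : ℕ} (hℓ : ℓ ≤ L) (k : Fin (N.width ℓ)) :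
    Measurable[N.paramAlgebra {i | N.layer i < ℓ}] (N.coeff x ℓ k) :=
  (N.measurable_act_paramAlgebra x hℓ k).const_mul _

lemma measurable_coeff {ℓ : ℕ} (hℓ : ℓ ≤ L) (k : Fin (N.width ℓ)) : Measurable (N.coeff x ℓ k) :=
  (N.measurable_coeff_paramAlgebra x hℓ k).mono (N.paramAlgebra_le _) le_rfl

lemma measurable_linearForm {ℓ : ℕ} (hℓ : ℓ ≤ L) (j : Fin (N.width (ℓ + 1))) :
    Measurable fun ω => ∑ k, N.coeff x ℓ k ω * N.weight ℓ j k ω :=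
  Finset.measurable_sum _ fun k _ =>
    (N.measurable_coeff x hℓ k).mul (N.measurable_weight ℓ hℓ j k)

lemma measurable_z_succ {ℓ : ℕ} (hℓ : ℓ ≤ L) (j : Fin (N.width (ℓ + 1))) :
    Measurable (N.z x (ℓ + 1) j) := by
  rw [z_succ]
  exact (N.measurable_bias ℓ hℓ j).add (N.measurable_linearForm x hℓ j)

lemma measurable_z {ℓ : ℕ} (hℓ : ℓ ≤ L + 1) (j : Fin (N.width ℓ)) : Measurable (N.z x ℓ j) := by
  cases ℓ with
  | zero => exact measurable_const
  | succ ℓ => exact N.measurable_z_succ x (Nat.le_of_succ_le_succ hℓ) j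

lemma indepFun_weight_coeff {ℓ : ℕ} (hℓ : ℓ ≤ L) (j : Fin (N.width (ℓ + 1))) :
    IndepFun (fun ω k => N.weight ℓ j k ω) (fun ω k => N.coeff x ℓ k ω) P := by
  have hlt : ℓ < L + 1 := Nat.lt_succ_of_le hℓ
  let row : Set N.ParamIndex := Set.range fun k => Sum.inl ⟨⟨ℓ, hlt⟩, j, k⟩
  have hdisj : Disjoint row {i | N.layer i < ℓ} := by
    rw [Set.disjoint_left]
    rintro _ ⟨k, rfl⟩ h
    exact lt_irrefl ℓ h
  exact N.indepFun_of_measurable_paramAlgebra hdisj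
    (@measurable_pi_lambda _ _ _ (N.paramAlgebra row) _ _ fun k =>
      N.measurable_weight_paramAlgebra hlt ⟨k, rfl⟩)
    (@measurable_pi_lambda _ _ _ (N.paramAlgebra {i | N.layer i < ℓ}) _ _ fun k =>
      N.measurable_coeff_paramAlgebra x hℓ k)

lemma indepFun_bias_linearForm {ℓ : ℕ} (hℓ : ℓ ≤ L) (j : Fin (N.width (ℓ + 1))) :
    IndepFun (N.bias ℓ j) (fun ω => ∑ k, N.coeff x ℓ k ω * N.weight ℓ j k ω) P := by
  have hlt : ℓ < L + 1 := Nat.lt_succ_of_le hℓ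
  let row : Set N.ParamIndex := Set.range fun k => Sum.inl ⟨⟨ℓ, hlt⟩, j, k⟩
  have hdisj : Disjoint {Sum.inr ⟨⟨ℓ, hlt⟩, j⟩} (row ∪ {i | N.layer i < ℓ}) := by
    rw [Set.disjoint_singleton_left]
    rintro (⟨k, h⟩ | h)
    · exact Sum.inl_ne_inr h
    · exact lt_irrefl ℓ h
  refine N.indepFun_of_measurable_paramAlgebra hdisj (N.measurable_bias_paramAlgebra hlt rfl)
    (Finset.measurable_sum _ fun k _ => Measurable.mul ?_ ?_)
  · exact (N.measurable_coeff_paramAlgebra x hℓ k).mono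
      (N.paramAlgebra_mono Set.subset_union_right) le_rfl
  · exact N.measurable_weight_paramAlgebra hlt (Or.inl ⟨k, rfl⟩)

lemma hasLaw_weight_row {ℓ : ℕ} (hℓ : ℓ ≤ L) (j : Fin (N.width (ℓ + 1))) :
    HasLaw (fun ω k => N.weight ℓ j k ω) (Measure.pi fun _ => N.weightLaw) P := by
  have hinj : Function.Injective fun k : Fin (N.width ℓ) =>
      (Sum.inl ⟨⟨ℓ, Nat.lt_succ_of_le hℓ⟩, j, k⟩ : N.ParamIndex) := fun k k' h => by
    simpa using h
  have hind := N.indep.precomp hinj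
  replace hind : iIndepFun (fun k => N.weight ℓ j k) P := hind
  exact hind.hasLaw_pi fun k => N.hasLaw_weight ℓ hℓ j k

end Parameters

section Law

variable [IsProbabilityMeasure P]

lemma isProbabilityMeasure_weightLaw : IsProbabilityMeasure N.weightLaw :=
  (N.hasLaw_weight 0 (Nat.zero_le L) (N.fst 1) (N.fst 0)).isProbabilityMeasure_iff.1 inferInstance

lemma integrable_cdf_linear {n : ℕ} (μ ν : Measure (Fin n → ℝ)) [IsFiniteMeasure μ]
    [IsFiniteMeasure ν] (ξ : Measure ℝ) (t : ℝ) :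
    Integrable (fun p : (Fin n → ℝ) × (Fin n → ℝ) => cdf ξ (t - ∑ k, p.2 k * p.1 k)) (μ.prod ν) :=
  integrable_cdf_comp (by fun_prop)

lemma cdf_map_z_succ {ℓ : ℕ} (hℓ : ℓ ≤ L) (j : Fin (N.width (ℓ + 1))) (t : ℝ) :
    cdf (P.map (N.z x (ℓ + 1) j)) t =
      ∫ ω, ∫ u, cdf (gaussianReal 0 N.Cb) (t - ∑ k, N.coeff x ℓ k ω * u k)
        ∂Measure.pi (fun _ => N.weightLaw) ∂P := by
  have := N.isProbabilityMeasure_weightLaw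
  rw [z_succ, cdf_map_add_eq_of_indepFun (N.hasLaw_bias ℓ hℓ j)
    (N.measurable_linearForm x hℓ j).aemeasurable (N.indepFun_bias_linearForm x hℓ j)]
  exact integral_comp_prodMk_eq_of_indepFun (N.hasLaw_weight_row hℓ j)
    (measurable_pi_lambda _ fun k => N.measurable_coeff x hℓ k).aemeasurable
    (N.indepFun_weight_coeff x hℓ j) (integrable_cdf_linear _ _ _ t)

lemma integrable_integral_cdf_coeff {ℓ : ℕ} (hℓ : ℓ ≤ L) (t : ℝ) :
    Integrable (fun ω => ∫ u, cdf (gaussianReal 0 N.Cb) (t - ∑ k, N.coeff x ℓ k ω * u k)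
      ∂Measure.pi fun _ => N.weightLaw) P := by
  have := N.isProbabilityMeasure_weightLaw
  have hcoeff : Measurable fun ω k => N.coeff x ℓ k ω :=
    measurable_pi_lambda _ fun k => N.measurable_coeff x hℓ k
  exact (integrable_cdf_linear (Measure.pi fun _ => N.weightLaw) (P.map fun ω k => N.coeff x ℓ k ω)
    (gaussianReal 0 N.Cb) t).integral_prod_right.comp_measurable hcoeff

lemma identDistrib_z_succ {ℓ : ℕ} (hℓ : ℓ ≤ L) (j j' : Fin (N.width (ℓ + 1))) :
    IdentDistrib (N.z x (ℓ + 1) j) (N.z x (ℓ + 1) j') P P := by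
  have hz (i : Fin (N.width (ℓ + 1))) : AEMeasurable (N.z x (ℓ + 1) i) P :=
    (N.measurable_z_succ x hℓ i).aemeasurable
  have := Measure.isProbabilityMeasure_map (hz j)
  have := Measure.isProbabilityMeasure_map (hz j')
  refine ⟨hz j, hz j', Measure.eq_of_cdf _ _ ?_⟩
  ext t
  rw [N.cdf_map_z_succ x hℓ, N.cdf_map_z_succ x hℓ]

lemma identDistrib_act_succ {ℓ : ℕ} (hℓ : ℓ ≤ L) (k k' : Fin (N.width (ℓ + 1))) :
    IdentDistrib (N.act x (ℓ + 1) k) (N.act x (ℓ + 1) k') P P :=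
  (N.identDistrib_z_succ x hℓ k k').comp N.measurable_σ

end Law

section Coefficients

lemma coeff_sq (ℓ : ℕ) (k : Fin (N.width ℓ)) (ω : Ω) :
    N.coeff x ℓ k ω ^ 2 = (N.CW : ℝ) / N.width ℓ * N.act x ℓ k ω ^ 2 := by
  rw [coeff, mul_pow, div_pow, Real.sq_sqrt N.CW.coe_nonneg, Real.sq_sqrt (Nat.cast_nonneg _)]

lemma integral_sq_sub_sum_coeff_sq (ℓ : ℕ) :
    ∫ ω, ((N.K x (ℓ + 2) : ℝ) - N.Cb - ∑ k, N.coeff x (ℓ + 1) k ω ^ 2) ^ 2 ∂P =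
      N.Q x 2 (ℓ + 1) := by
  rw [Q]
  congr with ω
  simp only [coeff_sq, act, sq_abs]
  ring

variable [IsProbabilityMeasure P] {x} {ℓ : ℕ}

lemma memLp_coeff_succ (hℓ : ℓ ≤ L) (hact : MemLp (N.act x (ℓ + 1) (N.fst (ℓ + 1))) 4 P)
    (k : Fin (N.width (ℓ + 1))) : MemLp (N.coeff x (ℓ + 1) k) 4 P :=
  ((N.identDistrib_act_succ x hℓ _ k).memLp_iff.1 hact).const_mul _

lemma memLp_sub_sum_coeff_sq (hℓ : ℓ ≤ L) (hact : MemLp (N.act x (ℓ + 1) (N.fst (ℓ + 1))) 4 P)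
    (r : ℝ) : MemLp (fun ω => r - ∑ k, N.coeff x (ℓ + 1) k ω ^ 2) 2 P := by
  refine (memLp_const r).sub (memLp_finsetSum _ fun k _ => ?_)
  have hcoeff := N.memLp_coeff_succ hℓ hact k
  simpa only [sq] using memLp_two_mul hcoeff hcoeff

lemma integrable_sum_coeff_pow_four (hℓ : ℓ ≤ L)
    (hact : MemLp (N.act x (ℓ + 1) (N.fst (ℓ + 1))) 4 P) :
    Integrable (fun ω => ∑ k, N.coeff x (ℓ + 1) k ω ^ 4) P :=
  integrable_finsetSum _ fun k _ =>
    integrable_pow_of_memLp (N.memLp_coeff_succ hℓ hact k) (by norm_num)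

lemma integral_sum_coeff_pow_four (hℓ : ℓ ≤ L)
    (hact : MemLp (N.act x (ℓ + 1) (N.fst (ℓ + 1))) 4 P) :
    ∫ ω, ∑ k, N.coeff x (ℓ + 1) k ω ^ 4 ∂P = ((N.CW : ℝ) / √(N.width (ℓ + 1) : ℝ)) ^ 2 *
      ∫ ω, N.act x (ℓ + 1) (N.fst (ℓ + 1)) ω ^ 4 ∂P := by
  have hwidth : (0 : ℝ) < N.width (ℓ + 1) := Nat.cast_pos.2 (N.width_pos (ℓ + 1))
  have hcoeff (k) : ∫ ω, N.coeff x (ℓ + 1) k ω ^ 4 ∂P = ((N.CW : ℝ) / N.width (ℓ + 1)) ^ 2 *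
      ∫ ω, N.act x (ℓ + 1) (N.fst (ℓ + 1)) ω ^ 4 ∂P := by
    have hact_eq : ∫ ω, N.act x (ℓ + 1) (N.fst (ℓ + 1)) ω ^ 4 ∂P =
        ∫ ω, N.act x (ℓ + 1) k ω ^ 4 ∂P :=
      ((N.identDistrib_act_succ x hℓ (N.fst (ℓ + 1)) k).comp
        (measurable_id.pow_const 4)).integral_eq
    rw [hact_eq, ← integral_const_mul]
    congr with ω
    rw [pow_mul _ 2 2, coeff_sq, mul_pow, ← pow_mul]
  rw [integral_finsetSum _ fun k _ =>
    integrable_pow_of_memLp (N.memLp_coeff_succ hℓ hact k) (by norm_num)]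
  simp only [hcoeff, Finset.sum_const, Finset.card_univ, Fintype.card_fin, nsmul_eq_mul]
  rw [div_pow, div_pow, Real.sq_sqrt hwidth.le]
  field_simp

lemma integral_sqrt_sum_coeff_pow_four_le (hℓ : ℓ ≤ L)
    (hact : MemLp (N.act x (ℓ + 1) (N.fst (ℓ + 1))) 4 P) :
    ∫ ω, √(∑ k, N.coeff x (ℓ + 1) k ω ^ 4) ∂P ≤ (N.CW : ℝ) / √(N.width (ℓ + 1) : ℝ) *
      √(∫ ω, N.act x (ℓ + 1) (N.fst (ℓ + 1)) ω ^ 4 ∂P) := by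
  have h := integral_sqrt_le_sqrt_integral (N.integrable_sum_coeff_pow_four hℓ hact)
    fun ω => Finset.sum_nonneg fun k _ => by positivity
  rwa [N.integral_sum_coeff_pow_four hℓ hact, Real.sqrt_mul (sq_nonneg _),
    Real.sqrt_sq (by positivity)] at h

end Coefficients

theorem kolDist_z_succ_le [IsProbabilityMeasure P] {ℓ : ℕ} (hℓ : 1 ≤ ℓ) (hℓL : ℓ ≤ L)
    (hw : MemLp id 4 N.weightLaw)
    (hσ : MemLp (fun ω => N.σ (N.z x ℓ (N.fst ℓ) ω)) 4 P)
    (hK : N.K x (ℓ + 1) ≠ 0) (j : Fin (N.width (ℓ + 1))) :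
    kolDist (P.map (N.z x (ℓ + 1) j)) (gaussianReal 0 (N.K x (ℓ + 1))) ≤
      1 / (N.K x (ℓ + 1) : ℝ) * (√(N.Q x 2 ℓ) + 5 / 2 * √(∫ u, u ^ 4 ∂N.weightLaw) *
        ((N.CW : ℝ) / √(N.width ℓ : ℝ) * √(∫ ω, N.σ (N.z x ℓ (N.fst ℓ) ω) ^ 4 ∂P))) := by
  obtain ⟨ℓ, rfl⟩ : ∃ i, ℓ = i + 1 := ⟨ℓ - 1, by omega⟩
  have hpred : ℓ ≤ L := Nat.le_of_succ_le hℓL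
  have := N.isProbabilityMeasure_weightLaw
  have := Measure.isProbabilityMeasure_map (μ := P) (N.measurable_z_succ x hℓL j).aemeasurable
  set K := N.K x (ℓ + 2)
  set D : Ω → ℝ := fun ω => (K : ℝ) - N.Cb - ∑ k, N.coeff x (ℓ + 1) k ω ^ 2
  set S : Ω → ℝ := fun ω => √(∑ k, N.coeff x (ℓ + 1) k ω ^ 4)
  set m4 := ∫ u, u ^ 4 ∂N.weightLaw
  have hD : MemLp D 2 P := N.memLp_sub_sum_coeff_sq hpred hσ _
  have hDint : Integrable (fun ω => |D ω|) P := (hD.integrable one_le_two).abs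
  have hS : Integrable (fun ω => 5 / 2 * √m4 * S ω) P :=
    ((memLp_two_sqrt (N.integrable_sum_coeff_pow_four hpred hσ) fun ω =>
      Finset.sum_nonneg fun k _ => by positivity).integrable one_le_two).const_mul _
  refine kolDist_le_of_forall_abs_cdf_sub_le fun t => ?_
  calc |cdf (P.map (N.z x (ℓ + 2) j)) t - cdf (gaussianReal 0 K) t|
      = ‖∫ ω, (∫ u, cdf (gaussianReal 0 N.Cb) (t - ∑ k, N.coeff x (ℓ + 1) k ω * u k)
          ∂Measure.pi (fun _ => N.weightLaw) - cdf (gaussianReal 0 K) t) ∂P‖ := by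
        rw [N.cdf_map_z_succ x hℓL, integral_sub (N.integrable_integral_cdf_coeff x hℓL t)
          (integrable_const _), integral_const, probReal_univ, one_smul, Real.norm_eq_abs]
    _ ≤ ∫ ω, 1 / (K : ℝ) * (|D ω| + 5 / 2 * √m4 * S ω) ∂P :=
        norm_integral_le_of_norm_le ((hDint.add hS).const_mul _) (ae_of_all _ fun ω =>
          abs_integral_cdf_linear_sub_le hw N.mean_weightLaw N.sq_weightLaw _ N.Cb hK t)
    _ = 1 / (K : ℝ) * (∫ ω, |D ω| ∂P + 5 / 2 * √m4 * ∫ ω, S ω ∂P) := by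
        rw [integral_const_mul, integral_add hDint hS, integral_const_mul]
    _ ≤ _ := by
        gcongr
        · rw [← N.integral_sq_sub_sum_coeff_sq]
          exact integral_abs_le_sqrt_integral_sq hD
        · exact N.integral_sqrt_sum_coeff_pow_four_le hpred hσ

end RandomNN

theorem mainTheorem6_general {Ω : Type*} [MeasurableSpace Ω] (P : Measure Ω)
    [IsProbabilityMeasure P] :
    (∀ (L ℓ : ℕ), 1 ≤ ℓ → ℓ ≤ L → ∀ (N : RandomNN P L) (x : Fin (N.width 0) → ℝ)
      (j : Fin (N.width (ℓ + 1))),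
      MemLp (N.weight 0 (N.fst 1) (N.fst 0)) 4 P →
      MemLp (fun ω => N.σ (N.z x ℓ (N.fst ℓ) ω)) 4 P →
      N.K x (ℓ + 1) ≠ 0 →
      kolDist (P.map (N.z x (ℓ + 1) j)) (gaussianReal 0 (N.K x (ℓ + 1))) ≤
        1 / (N.K x (ℓ + 1) : ℝ) * √(N.Q x 2 ℓ) +
        (N.CW : ℝ) / ((N.K x (ℓ + 1) : ℝ) * √(N.width ℓ : ℝ)) *
          √(∫ ω, N.weight 0 (N.fst 1) (N.fst 0) ω ^ 4 ∂P) *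
          √(∫ ω, N.σ (N.z x ℓ (N.fst ℓ) ω) ^ 4 ∂P) * (5 / 2)) ∧
    (∀ {E : Type*} [MeasurableSpace E] (k : ℕ) (X X' : Ω → Fin k → E) (b : Ω → ℝ)
      (f : (Fin k → E) → ℝ) (Cb K : ℝ≥0),
      Measurable X → Measurable f →
      iIndepFun (fun i ω => X ω i) P →
      IdentDistrib X' X P P → IndepFun X X' P →
      HasLaw b (gaussianReal 0 Cb) P → IndepFun b X P →
      K ≠ 0 →
      MemLp (fun ω => f (X ω)) 4 P →
      ∫ ω, f (X ω) ∂P = 0 →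
      kolDist (P.map fun ω => b ω + f (X ω)) (gaussianReal 0 K) ≤
        1 / (K : ℝ) *
          √(∫ ω, (P[fun ω' => (K : ℝ) - (Cb : ℝ) - steinT f (X ω') (X' ω') |
            MeasurableSpace.comap X inferInstance] ω) ^ 2 ∂P) +
        1 / (K : ℝ) *
          √(variance (P[fun ω' => steinT' f (X ω') (X' ω') |
            MeasurableSpace.comap X inferInstance]) P)) := by
  refine ⟨fun L ℓ hℓ hℓL N x j hw hσ hK => ?_,
    fun k X X' b f Cb K hX hf hind hid hXX' hb hbX hK hf4 h0 => ?_⟩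
  · have hlaw := N.hasLaw_weight 0 (Nat.zero_le L) (N.fst 1) (N.fst 0)
    have fourth_moment : ∫ ω, N.weight 0 (N.fst 1) (N.fst 0) ω ^ 4 ∂P = ∫ u, u ^ 4 ∂N.weightLaw :=
      hlaw.integral_comp (f := fun u => u ^ 4) (by fun_prop)
    refine (N.kolDist_z_succ_le x hℓ hℓL
      ((memLp_comp_iff_of_hasLaw hlaw aestronglyMeasurable_id).1 hw) hσ hK j).trans_eq ?_
    rw [fourth_moment, ← div_div]
    ring
  · obtain ⟨μ, _, hpair⟩ := exists_hasLaw_pairLaw hX hind hid hXX'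
    have hlaw : HasLaw X (Measure.pi μ) P := measurePreserving_fst.hasLaw.comp hpair
    exact kolDist_add_le_of_hasLaw_pairLaw hX hpair hf hb hbX hK
      ((memLp_comp_iff_of_hasLaw hlaw hf.aestronglyMeasurable).1 hf4)
      ((hlaw.integral_comp hf.aestronglyMeasurable).symm.trans h0)

end

theorem mainTheorem6 {Ω : Type*} [MeasurableSpace Ω] (P : Measure Ω) [IsProbabilityMeasure P] :
    -- the bound for the neural network
    (∀ (L : ℕ), 1 ≤ L → ∀ (N : RandomNN P L) (x : Fin (N.width 0) → ℝ),
      Integrable (fun ω => N.weight 0 (N.fst 1) (N.fst 0) ω ^ 6) P →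
      Integrable (fun ω => |N.σ (N.z x L (N.fst L) ω)| ^ 6) P →
      N.K x (L + 1) ≠ 0 →
      kolDist (P.map (N.z x (L + 1) (N.fst (L + 1)))) (gaussianReal 0 (N.K x (L + 1))) ≤
        1 / (N.K x (L + 1) : ℝ) * √(N.Q x 2 L) +
        (N.CW : ℝ) / ((N.K x (L + 1) : ℝ) * √(N.width L : ℝ)) *
          √(∫ ω, N.weight 0 (N.fst 1) (N.fst 0) ω ^ 6 ∂P) *
          (1 + √(∫ ω, |N.σ (N.z x L (N.fst L) ω)| ^ 6 ∂P)) *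
          (2 * √((N.CW : ℝ) / (N.K x (L + 1) : ℝ)) +
            2 * √(N.CW : ℝ) *
              (√((N.Cb : ℝ) / (N.K x (L + 1) : ℝ)) + √(2 * Real.pi) / 4) +
            5 / 2)) ∧
    -- the bound for a Gaussian variable plus a function of independent variables
    (∀ {E : Type*} [TopologicalSpace E] [PolishSpace E] [MeasurableSpace E] [BorelSpace E]
      (k : ℕ) (X X' : Ω → Fin k → E) (b : Ω → ℝ) (f : (Fin k → E) → ℝ) (Cb K : ℝ≥0),
      Measurable X → Measurable X' → Measurable b → Measurable f →
      iIndepFun (fun i ω => X ω i) P →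
      IdentDistrib X' X P P → IndepFun X X' P →
      HasLaw b (gaussianReal 0 Cb) P → IndepFun b X P →
      K ≠ 0 →
      Integrable (fun ω => f (X ω) ^ 6) P →
      ∫ ω, f (X ω) ∂P = 0 →
      kolDist (P.map (fun ω => b ω + f (X ω))) (gaussianReal 0 K) ≤
        1 / (K : ℝ) *
          √(∫ ω, (P[fun ω' => (K : ℝ) - (Cb : ℝ) - steinT f (X ω') (X' ω') |
            MeasurableSpace.comap X inferInstance] ω) ^ 2 ∂P) +
        1 / (K : ℝ) *
          √(variance (P[fun ω' => steinT' f (X ω') (X' ω') |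
            MeasurableSpace.comap X inferInstance]) P) +
        1 / 4 * (√((Cb : ℝ) / (K : ℝ)) + √(2 * Real.pi) / 4) *
          ∑ j : Fin k, 1 / (K : ℝ) * ∫ ω, |resampleDiff f j ∅ (X ω) (X' ω)| ^ 3 ∂P +
        1 / (4 * (K : ℝ) * √(K : ℝ)) *
          ∑ j : Fin k, √(∫ ω, |resampleDiff f j ∅ (X ω) (X' ω)| ^ 6 ∂P)) := by
  obtain ⟨network, functional⟩ := mainTheorem6_general P
  refine ⟨fun L hL N x hw hσ hK => ?_,
    fun k X X' b f Cb K hX _ _ hf hind hid hXX' hb hbX hK hf6 h0 => ?_⟩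
  · have hw6 : MemLp (N.weight 0 (N.fst 1) (N.fst 0)) 6 P :=
      memLp_of_integrable_abs_pow (N.measurable_weight 0 (Nat.zero_le L) _ _).aestronglyMeasurable
        (by norm_num) (by simpa only [Even.pow_abs (by decide : Even 6)] using hw)
    have hσ6 : MemLp (fun ω => N.σ (N.z x L (N.fst L) ω)) 6 P :=
      memLp_of_integrable_abs_pow
        (N.measurable_σ.comp (N.measurable_z x (Nat.le_succ L) _)).aestronglyMeasurable
        (by norm_num) hσ
    refine (network L L hL le_rfl N x _ (hw6.mono_exponent (by norm_num))
      (hσ6.mono_exponent (by norm_num)) hK).trans (add_le_add_right ?_ _)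
    exact sqrt_integral_pow_four_mul_le hw6 (N.integral_weight_sq (Nat.zero_le L) _ _) hσ6
      (by positivity) (by positivity) (by positivity)
  · have hf6' : MemLp (fun ω => f (X ω)) 6 P :=
      memLp_of_integrable_abs_pow (hf.comp hX).aestronglyMeasurable
        (by norm_num)
        (by simpa only [Even.pow_abs (by decide : Even 6), Function.comp_apply] using hf6)
    refine (functional k X X' b f Cb K hX hf hind hid hXX' hb hbX hK
      (hf6'.mono_exponent (by norm_num)) h0).trans ?_
    rw [add_assoc _ _ (1 / (4 * (K : ℝ) * √(K : ℝ)) * _)]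
    exact le_add_of_nonneg_right (by positivity)
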